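/- Let $\Gamma$ be a finite alphabet and $L\subseteq\Gamma^*$ a regular language. Then: (i) there is a 4-layer RWKV-7 model with vocabulary $\Gamma$ that, for every non-empty word $w\in\Gamma^*$, outputs $1$ at the last token of $w$ if $w\in L$ and $0$ if $w\notin L$; (ii) there is a 4-layer RWKV-7 model with vocabulary $\Gamma\cup\{\#\}$, where $\#\notin\Gamma$ is a beginning-of-sequence token, that, for every word $w\in\Gamma^*$ (including the empty one), reading $\#w$ outputs $1$ at the last token if $w\in L$ and $0$ if $w\notin L$. In both cases all divisions performed by the model on these inputs are by nonzero numbers. Here an *RWKV-7 model* is the following map, in exact real arithmetic. Vectors are rows of dimension $D=HN$ with $H,N\ge 1$, split into $H$ heads of size $N$. Write $\mathrm{lerp}(a,b,x)=a+(b-a)\odot x$, $\sigma$ for the sigmoid, and $\mathrm{LN}$ for normalization to mean $0$ and variance $1$ followed by a trainable channelwise affine map. The matrices $\mathbf W_\square$ are $D\times D$ except in the MLP; $\mathbf A_\square$ is $D\times q$ and $\mathbf B_\square$ is $q\times D$, with any inner dimension $q$. All matrices, the vectors $\mu,\lambda,\xi,\alpha,\rho$, the embedding and the output vector are trainable (arbitrary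 real) parameters, chosen separately in each layer where they belong to a layer, and fixed independently of the input word. The residual stream starts as $\mathrm{LN}$ of the token embeddings. Each layer adds to the residual stream first the output of its time mixing module applied to $\mathrm{LN}$ of the stream, and then the output of its MLP module applied to $\mathrm{LN}$ of the new stream. The output at a position is $\mathrm{LN}$ of the final stream, multiplied by a trainable output vector. *Time mixing* on an input sequence $x_1,x_2,\dots$ ($x_0=0$): put $x^\square_t=\mathrm{lerp}(x_t,x_{t-1},\mu_\square)$ for $\square\in\{r,k,v,d,a,g\}$ and $$a_t=\sigma(x^a_t\mathbf A_a\mathbf B_a+\lambda_a),\quad k_t=x^k_t\mathbf W_k,\quad \kappa_t=k_t\odot\xi,\quad \tilde k_t=k_t\odot\mathrm{lerp}(1,a_t,\alpha),$$ $$\nu_t=\sigma(x^v_t\mathbf A_\nu\mathbf B_\nu+\lambda_\nu),\quad v'_t=x^v_t\mathbf W_v,\quad d_t=\tanh(x^d_t\mathbf A_d)\mathbf B_d+\lambda_d,\quad w_t=\exp(-e^{-0.5}\sigma(d_t)),$$ $$r_t=x^r_t\mathbf W_r,\quad g_t=\sigma(x^g_t\mathbf A_g)\mathbf B_g,$$ with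 $v_t=v'_t$ in the first layer and $v_t=\mathrm{lerp}(v'_{t,\text{first layer}},v'_t,\nu_t)$ in later layers. Per head, with $\hat\kappa_t=\kappa_t/\|\kappa_t\|_2$, $$\mathbf{wkv}_0=0,\quad \mathbf{wkv}_t=\mathbf{wkv}_{t-1}\bigl(\mathrm{diag}(w_t)-\hat\kappa_t^{T}(a_t\odot\hat\kappa_t)\bigr)+v_t^{T}\tilde k_t,$$ $$p_t=\mathrm{LN}(r_t\mathbf{wkv}_t^{T})+\bigl(r_t(\rho\odot\tilde k_t)^T\bigr)v_t .$$ The output is $(g_t\odot p_t)\mathbf W_o$, where $p_t\in\mathbb R^D$ collects all heads. *MLP* on an input sequence $x'_1,x'_2,\dots$ ($x'_0=0$): $\mathrm{ReLU}\bigl(\mathrm{lerp}(x'_t,x'_{t-1},\mu')\mathbf W_{k'}\bigr)^2\,\mathbf W_{v'}$ with $\mathbf W_{k'}\in\mathbb R^{D\times 4D}$, $\mathbf W_{v'}\in\mathbb R^{4D\times D}$ and the square taken entrywise. -/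

import Mathlib

open scoped Matrix

noncomputable section

namespace RWKV7

/-! Vectors are row vectors, so a matrix `W` acts on `x` as `x ᵥ* W`.  All arithmetic is exact real
arithmetic.  Positions are counted from `0`. -/

/-- Channels of a model with `H` heads of size `N`; the model dimension is `D = H * N`, and
`(h, i)` is the `i`-th channel of head `h`. -/
abbrev Chan (H N : ℕ) : Type := Fin H × Fin N

/-- Activations: row vectors of dimension `D`. -/
abbrev Vec (H N : ℕ) : Type := Chan H N → ℝ

/-- The part of a `D`-dimensional vector that belongs to head `h`. -/
def headPart {H N : ℕ} (x : Vec H N) (h : Fin H) : Fin N → ℝ := fun i => x (h, i)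

/-- Channelwise linear interpolation `a + (b - a) ⊙ x`. -/
def lerp {ι : Type} (a b x : ι → ℝ) : ι → ℝ := a + (b - a) * x

def mean {ι : Type} [Fintype ι] (x : ι → ℝ) : ℝ := (∑ i, x i) / Fintype.card ι

def variance {ι : Type} [Fintype ι] (x : ι → ℝ) : ℝ :=
  (∑ i, (x i - mean x) ^ 2) / Fintype.card ι

/-- Learned scale and shift of a normalization. -/
structure Affine (ι : Type) where
  weight : ι → ℝ
  bias : ι → ℝ

/-- Normalization to mean zero and variance one, followed by a learned channelwise affine map. -/
def layerNorm {ι : Type} [Fintype ι] (p : Affine ι) (x : ι → ℝ) : ι → ℝ :=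
  fun i => (x i - mean x) / Real.sqrt (variance x) * p.weight i + p.bias i

/-- Normalization applied separately to each head. -/
def groupNorm {H N : ℕ} (p : Affine (Chan H N)) (x : Vec H N) : Vec H N :=
  fun c => layerNorm ⟨headPart p.weight c.1, headPart p.bias c.1⟩ (headPart x c.1) c.2

def norm2 {ι : Type} [Fintype ι] (x : ι → ℝ) : ℝ := Real.sqrt (∑ i, x i ^ 2)

/-- The two matrices of a low-rank MLP. -/
structure Lora (H N : ℕ) where
  rank : ℕ
  A : Matrix (Chan H N) (Fin rank) ℝ
  B : Matrix (Fin rank) (Chan H N) ℝ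

/-- `f(x A) B`, where `f` is applied entrywise. -/
def Lora.apply {H N : ℕ} (p : Lora H N) (f : ℝ → ℝ) (x : Vec H N) : Vec H N :=
  (fun i => f ((x ᵥ* p.A) i)) ᵥ* p.B

/-- The sequence delayed by one position, starting with the zero vector. -/
def shift {ι : Type} (x : ℕ → ι → ℝ) : ℕ → ι → ℝ
  | 0 => 0
  | t + 1 => x t

/-- Token shift with mixing coefficients `μ`: interpolation between `x_t` and `x_{t-1}`. -/
def tokenShift {ι : Type} (μ : ι → ℝ) (x : ℕ → ι → ℝ) (t : ℕ) : ι → ℝ :=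
  lerp (x t) (shift x t) μ

/-- Trainable parameters of a time-mixing module. -/
structure TimeMix (H N : ℕ) where
  (μr μk μv μd μa μg : Vec H N)
  (Wr Wk Wv Wo : Matrix (Chan H N) (Chan H N) ℝ)
  (loraA loraNu loraD loraG : Lora H N)
  (biasA biasNu biasD : Vec H N)
  /-- removal key multiplier -/
  ξ : Vec H N
  /-- replacement rate booster -/
  α : Vec H N
  /-- bonus weight -/
  ρ : Vec H N
  /-- scale and shift of the per-head normalization -/
  headNorm : Affine (Chan H N)

namespace TimeMix

variable {H N : ℕ} (p : TimeMix H N) (x : ℕ → Vec H N)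

/-- In-context learning rate. -/
def iclr (t : ℕ) : Vec H N :=
  fun c => Real.sigmoid ((p.loraA.apply id (tokenShift p.μa x t) + p.biasA) c)

/-- Key precursor. -/
def key (t : ℕ) : Vec H N := tokenShift p.μk x t ᵥ* p.Wk

/-- Removal key, before normalization. -/
def removalKey (t : ℕ) : Vec H N := p.key x t * p.ξ

/-- Removal key, normalized per head. -/
def removalKeyHat (t : ℕ) : Vec H N :=
  fun c => p.removalKey x t c / norm2 (headPart (p.removalKey x t) c.1)

/-- Replacement key. -/
def replacementKey (t : ℕ) : Vec H N := p.key x t * lerp 1 (p.iclr x t) p.α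

/-- Value residual gate. -/
def valueGate (t : ℕ) : Vec H N :=
  fun c => Real.sigmoid ((p.loraNu.apply id (tokenShift p.μv x t) + p.biasNu) c)

/-- Value precursor. -/
def valuePre (t : ℕ) : Vec H N := tokenShift p.μv x t ᵥ* p.Wv

/-- Value.  The argument `v0` is `none` in the first layer, and in every later layer it is the
sequence of value precursors of the first layer. -/
def value (v0 : Option (ℕ → Vec H N)) (t : ℕ) : Vec H N :=
  match v0 with
  | none => p.valuePre x t
  | some v => lerp (v t) (p.valuePre x t) (p.valueGate x t)

/-- Decay precursor. -/
def decayPre (t : ℕ) : Vec H N := p.loraD.apply Real.tanh (tokenShift p.μd x t) + p.biasD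

/-- Decay. -/
def decay (t : ℕ) : Vec H N :=
  fun c => Real.exp (-Real.exp (-0.5) * Real.sigmoid (p.decayPre x t c))

/-- Receptance. -/
def receptance (t : ℕ) : Vec H N := tokenShift p.μr x t ᵥ* p.Wr

/-- Gate. -/
def gate (t : ℕ) : Vec H N := p.loraG.apply Real.sigmoid (tokenShift p.μg x t)

/-- Transition matrix `diag(w_t) - κ̂_tᵀ (a_t ⊙ κ̂_t)` of head `h`. -/
def transition (t : ℕ) (h : Fin H) : Matrix (Fin N) (Fin N) ℝ :=
  Matrix.diagonal (headPart (p.decay x t) h) -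
    Matrix.vecMulVec (headPart (p.removalKeyHat x t) h)
      (headPart (p.iclr x t * p.removalKeyHat x t) h)

/-- State of head `h` after the first `t` positions have been read. -/
def wkv (v0 : Option (ℕ → Vec H N)) (h : Fin H) : ℕ → Matrix (Fin N) (Fin N) ℝ
  | 0 => 0
  | t + 1 => wkv v0 h t * p.transition x t h +
      Matrix.vecMulVec (headPart (p.value x v0 t) h) (headPart (p.replacementKey x t) h)

/-- Readout `r_t wkv_tᵀ` of all heads, before normalization. -/
def readout (v0 : Option (ℕ → Vec H N)) (t : ℕ) : Vec H N :=
  fun c => (headPart (p.receptance x t) c.1 ᵥ* (p.wkv x v0 c.1 (t + 1))ᵀ) c.2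

/-- Bonus for the current token. -/
def bonus (v0 : Option (ℕ → Vec H N)) (t : ℕ) : Vec H N :=
  fun c => (headPart (p.receptance x t) c.1 ⬝ᵥ headPart (p.ρ * p.replacementKey x t) c.1) *
    p.value x v0 t c

/-- Output of the time-mixing module at position `t`. -/
def out (v0 : Option (ℕ → Vec H N)) (t : ℕ) : Vec H N :=
  (p.gate x t * (groupNorm p.headNorm (p.readout x v0 t) + p.bonus x v0 t)) ᵥ* p.Wo

end TimeMix

/-- Trainable parameters of the MLP module, whose hidden dimension is `4 D`. -/
structure ChannelMix (H N : ℕ) where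
  μk : Vec H N
  Wk : Matrix (Chan H N) (Fin 4 × Chan H N) ℝ
  Wv : Matrix (Fin 4 × Chan H N) (Chan H N) ℝ

/-- Output of the MLP module at position `t`; the nonlinearity is the squared ReLU. -/
def ChannelMix.out {H N : ℕ} (p : ChannelMix H N) (x : ℕ → Vec H N) (t : ℕ) : Vec H N :=
  (fun i => (max ((tokenShift p.μk x t ᵥ* p.Wk) i) 0) ^ 2) ᵥ* p.Wv

/-- One layer: a time-mixing module and an MLP module, each preceded by a layer normalization and
bypassed by a residual connection. -/
structure Layer (H N : ℕ) where
  normTime : Affine (Chan H N)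
  timeMix : TimeMix H N
  normChan : Affine (Chan H N)
  channelMix : ChannelMix H N

namespace Layer

variable {H N : ℕ} (p : Layer H N) (v0 : Option (ℕ → Vec H N)) (x : ℕ → Vec H N)

/-- Input of the time-mixing module. -/
def timeIn (t : ℕ) : Vec H N := layerNorm p.normTime (x t)

/-- Residual stream between the two modules. -/
def mid (t : ℕ) : Vec H N := x t + p.timeMix.out (p.timeIn x) v0 t

/-- Input of the MLP module. -/
def chanIn (t : ℕ) : Vec H N := layerNorm p.normChan (p.mid v0 x t)

/-- Residual stream after the layer. -/
def out (t : ℕ) : Vec H N := p.mid v0 x t + p.channelMix.out (p.chanIn v0 x) t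

/-- No normalization in this layer divides by zero at position `t`. -/
def Regular (t : ℕ) : Prop :=
  variance (x t) ≠ 0 ∧
  (∀ h : Fin H, norm2 (headPart (p.timeMix.removalKey (p.timeIn x) t) h) ≠ 0 ∧
    variance (headPart (p.timeMix.readout (p.timeIn x) v0 t) h) ≠ 0) ∧
  variance (p.mid v0 x t) ≠ 0

end Layer

/-- An RWKV-7 model with vocabulary `V`, `H` heads of size `N`, `L` layers and one real output per
position. -/
structure Model (V : Type*) (H N L : ℕ) where
  embedding : V → Vec H N
  normIn : Affine (Chan H N)
  layer : Fin L → Layer H N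
  normOut : Affine (Chan H N)
  head : Vec H N

namespace Model

variable {V : Type*} {H N L : ℕ} (M : Model V H N L) (w : List V)

/-- Embedding of the token at position `t`.  Positions beyond the end of the word get the zero
vector; as the model is causal, they have no influence on positions inside the word. -/
def embed (t : ℕ) : Vec H N := (w[t]?).elim 0 M.embedding

/-- The normalized embeddings, which enter the first layer. -/
def stream0 (t : ℕ) : Vec H N := layerNorm M.normIn (M.embed w t)

/-- What layer `l` knows about the value precursors of the first layer: nothing if it is the first
layer itself. -/
def firstValue (l : Fin L) : Option (ℕ → Vec H N) :=
  if (l : ℕ) = 0 then none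
  else
    let p := M.layer ⟨0, Nat.lt_of_le_of_lt (Nat.zero_le _) l.isLt⟩
    some (p.timeMix.valuePre (p.timeIn (M.stream0 w)))

/-- The residual stream after the first `l` layers. -/
def stream : ℕ → ℕ → Vec H N
  | 0 => M.stream0 w
  | l + 1 =>
    if h : l < L then (M.layer ⟨l, h⟩).out (M.firstValue w ⟨l, h⟩) (stream l) else stream l

/-- Output of the model at position `t`. -/
def output (t : ℕ) : ℝ := layerNorm M.normOut (M.stream w L t) ⬝ᵥ M.head

/-- No normalization divides by zero while the model reads `w`. -/
def Regular : Prop :=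
  ∀ t < w.length, variance (M.embed w t) ≠ 0 ∧
    (∀ l : Fin L, (M.layer l).Regular (M.firstValue w l) (M.stream w l) t) ∧
    variance (M.stream w L t) ≠ 0

/-- The computation on `w` is well defined, and the output at the last token of `w` is `b`. -/
def Outputs (b : ℝ) : Prop := M.Regular w ∧ M.output w (w.length - 1) = b

end Model

end RWKV7

end

/-!
The stream after each layer is a one-hot code of finite information about the prefix that has been
read.  What has to be shown is that each layer can compute the information of the next stage.

Two facts make this possible.  First, normalization sends all vectors to a sphere, where finitely
many points are separated from each other by affine functions that are positive at one of them
only.  Hence the MLP module can be an arbitrary lookup table (`exists_channelMix_lookup`), and can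
replace the stream by the code of any information that the code of the previous stage and the
output of the time-mixing module determine.  All positive scalings in the state, such as decay, are
harmless, because the readout is normalized.  Second, with a constant decay `w` and a constant
learning rate `a`, the state evolves by the matrices `w - a * uᵀu`, where the unit vector `u` may be
any function of the information at the present position (`codeTimeMix`).  For `a = w` these are
multiples of orthogonal projections, and for `a > w` they reverse the direction `u`.
`Update.exists_model` reduces the theorem to the dynamics of the states.

* The first layer has constant `u` and `a > w`: the sign of its readout is the parity of the
  position (`parityUpdate_runs`).
* The second layer alternates between two vectors at a suitable angle, with `a > w`.  A step,
  followed by the exchange of the two vectors, is then similar to a multiple of a rotation of order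
  `m`, and the readout determines the position modulo `m` (`counterUpdate_runs`).
* The third layer has `a = w`.  It stores each token under its position modulo `m` after erasing the
  token stored there before, so that the readout determines the latest `m` tokens
  (`historyUpdate_runs`).
* The fourth layer has `a = w` and runs the automaton in blocks (`automatonUpdate_runs`).  While a
  block is read, the state vector, which starts as a positive multiple of a unit vector, undergoes
  the state transformation of the block before.  Two projections merge a state into another one: the
  projection along `e_x - e_y` sends both `e_x` and `e_y` to `(e_x + e_y) / 2`, and the projection
  along `e_x` then leaves `e_y / 2`.  With a second copy of the state space every map is a product
  of such merges (`foldl_mapKeys`).  The receptance takes care of the merges that are still to be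
  done, and of the tokens of the current block.

A beginning-of-sequence token is a letter that acts on the automaton as the identity.
-/

noncomputable section

namespace RWKV7

/-! ### Normalization -/

section Normalization

theorem variance_ne_zero_iff {ι : Type} [Fintype ι] {x : ι → ℝ} :
    variance x ≠ 0 ↔ ∃ i, x i ≠ mean x := by
  unfold variance
  constructor
  · intro h
    by_contra! hx
    apply h
    simp [hx]
  · rintro ⟨i, hi⟩
    have : Nonempty ι := ⟨i⟩
    have h1 : 0 < ∑ i, (x i - mean x) ^ 2 := by
      apply Finset.sum_pos' (fun _ _ => sq_nonneg _)
      exact ⟨i, Finset.mem_univ _, by have := sub_ne_zero.2 hi; positivity⟩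
    have h2 : (0 : ℝ) < Fintype.card ι := by exact_mod_cast Fintype.card_pos
    positivity

theorem variance_nonneg {ι : Type} [Fintype ι] (x : ι → ℝ) : 0 ≤ variance x := by
  unfold variance; positivity

theorem variance_ne_zero_of_ne {ι : Type} [Fintype ι] {x : ι → ℝ} {i j : ι} (h : x i ≠ x j) :
    variance x ≠ 0 := by
  rw [variance_ne_zero_iff]
  by_contra! hx
  exact h ((hx i).trans (hx j).symm)

/-- Normalization to mean zero and variance one, without the affine map. -/
def standardize {ι : Type} [Fintype ι] (x : ι → ℝ) : ι → ℝ :=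
  fun i => (x i - mean x) / Real.sqrt (variance x)

theorem layerNorm_eq {ι : Type} [Fintype ι] (p : Affine ι) (x : ι → ℝ) :
    layerNorm p x = standardize x * p.weight + p.bias := rfl

theorem sum_sub_mean {ι : Type} [Fintype ι] (x : ι → ℝ) : ∑ i, (x i - mean x) = 0 := by
  rcases isEmpty_or_nonempty ι with h | h
  · simp
  · have : (Fintype.card ι : ℝ) ≠ 0 := by exact_mod_cast Fintype.card_ne_zero
    simp only [Finset.sum_sub_distrib, mean]
    simp
    field_simp
    simp

theorem sum_standardize {ι : Type} [Fintype ι] (x : ι → ℝ) : ∑ i, standardize x i = 0 := by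
  simp only [standardize, ← Finset.sum_div, sum_sub_mean, zero_div]

theorem sum_standardize_sq {ι : Type} [Fintype ι] {x : ι → ℝ} (hx : variance x ≠ 0) :
    ∑ i, standardize x i ^ 2 = Fintype.card ι := by
  have hc : (Fintype.card ι : ℝ) ≠ 0 := by
    intro h
    apply hx
    simp [variance, h]
  simp only [standardize, div_pow, ← Finset.sum_div, Real.sq_sqrt (variance_nonneg x)]
  rw [div_eq_iff hx]
  unfold variance
  field_simp

theorem exists_affine_of_standardize_eq {ι : Type} [Fintype ι] {x y : ι → ℝ}
    (hx : variance x ≠ 0) (hy : variance y ≠ 0) (h : standardize x = standardize y) :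
    ∃ c > 0, ∃ b, ∀ i, x i = c * y i + b := by
  have hx' : 0 < Real.sqrt (variance x) :=
    Real.sqrt_pos.2 (lt_of_le_of_ne (variance_nonneg x) hx.symm)
  have hy' : 0 < Real.sqrt (variance y) :=
    Real.sqrt_pos.2 (lt_of_le_of_ne (variance_nonneg y) hy.symm)
  refine ⟨Real.sqrt (variance x) / Real.sqrt (variance y), by positivity,
    mean x - Real.sqrt (variance x) / Real.sqrt (variance y) * mean y, fun i => ?_⟩
  have := congrFun h i
  simp only [standardize] at this
  field_simp at this ⊢
  linarith

/-- For an affine map with this scale and shift, normalization fixes a given vector. -/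
theorem layerNorm_eq_self {ι : Type} [Fintype ι] {x : ι → ℝ} (hx : variance x ≠ 0) {s m : ℝ}
    (hs : variance x = s) (hm : mean x = m) :
    layerNorm ⟨fun _ => Real.sqrt s, fun _ => m⟩ x = x := by
  subst hs hm
  funext i
  have hx' : Real.sqrt (variance x) ≠ 0 :=
    (Real.sqrt_pos.2 (lt_of_le_of_ne (variance_nonneg x) hx.symm)).ne'
  simp only [layerNorm]
  field_simp
  ring

theorem standardize_of_mean_eq_zero {ι : Type} [Fintype ι] {x : ι → ℝ} (hx : ∑ i, x i = 0) :
    standardize x = (Real.sqrt (Fintype.card ι) / Real.sqrt (∑ i, x i ^ 2)) • x := by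
  have hm : mean x = 0 := by simp [mean, hx]
  funext i
  simp only [standardize, variance, hm, sub_zero, Pi.smul_apply, smul_eq_mul]
  rw [Real.sqrt_div (Finset.sum_nonneg fun _ _ => sq_nonneg _), div_div_eq_mul_div]
  ring

end Normalization

/-! ### The MLP module as a lookup table -/

theorem sum_mul_standardize_lt {ι : Type} [Fintype ι] {x y : ι → ℝ} (hx : variance x ≠ 0)
    (hy : variance y ≠ 0) (h : standardize x ≠ standardize y) :
    ∑ i, standardize x i * standardize y i < Fintype.card ι := by
  obtain ⟨i, hi⟩ := Function.ne_iff.1 h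
  have h1 : 0 < ∑ i, (standardize x i - standardize y i) ^ 2 := by
    apply Finset.sum_pos' (fun _ _ => sq_nonneg _)
    exact ⟨i, Finset.mem_univ _, by have := sub_ne_zero.2 hi; positivity⟩
  have h2 : ∑ i, (standardize x i - standardize y i) ^ 2
      = ∑ i, standardize x i ^ 2 + ∑ i, standardize y i ^ 2
        - 2 * ∑ i, standardize x i * standardize y i := by
    rw [Finset.mul_sum, ← Finset.sum_add_distrib, ← Finset.sum_sub_distrib]
    exact Finset.sum_congr rfl fun _ _ => by ring
  rw [h2, sum_standardize_sq hx, sum_standardize_sq hy] at h1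
  linarith

/-- The MLP module can realize an arbitrary function on finitely many inputs, provided that
normalization keeps these inputs apart.  Normalized vectors lie on a sphere, so that for each of
them some affine function is positive there and nonpositive at the others; these functions are the
hidden units.  The shift `1` of the normalization provides their constant terms. -/
theorem exists_channelMix_lookup {H N : ℕ} {I : Type*} [Finite I]
    (emb : I ↪ Fin 4 × Chan H N) (A : Set I) (m F : I → Vec H N)
    (hv : ∀ i ∈ A, variance (m i) ≠ 0)
    (hinj : ∀ i ∈ A, ∀ j ∈ A, standardize (m i) = standardize (m j) → i = j) :
    ∃ cm : ChannelMix H N, ∀ i ∈ A, ∀ x t, x t = layerNorm ⟨1, 1⟩ (m i) → cm.out x t = F i := by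
  classical
  set D : ℝ := ((Fintype.card (Chan H N) : ℕ) : ℝ) with hD
  obtain ⟨θ, hθD, hθ⟩ : ∃ θ < D, ∀ i ∈ A, ∀ j ∈ A, i ≠ j →
      ∑ c, standardize (m i) c * standardize (m j) c ≤ θ := by
    let g : I × I → ℝ := fun ij => if ij.1 ∈ A ∧ ij.2 ∈ A ∧ ij.1 ≠ ij.2 then
      ∑ c, standardize (m ij.1) c * standardize (m ij.2) c else D - 1
    rcases isEmpty_or_nonempty I with h | h
    · exact ⟨D - 1, by linarith, fun i => isEmptyElim i⟩
    · obtain ⟨ij, hij⟩ := Finite.exists_max g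
      refine ⟨g ij, ?_, fun i hi j hj hne => ?_⟩
      · simp only [g]
        split_ifs with h
        · exact sum_mul_standardize_lt (hv _ h.1) (hv _ h.2.1) fun he =>
            h.2.2 (hinj _ h.1 _ h.2.1 he)
        · linarith
      · have := hij (i, j)
        simp only [g] at this ⊢
        rwa [if_pos ⟨hi, hj, hne⟩] at this
  refine ⟨⟨0, fun c h => Function.extend emb (fun i => standardize (m i) c - θ / D) 0 h,
    fun h c => Function.extend emb (fun i => if i ∈ A then F i c / (D - θ) ^ 2 else 0) 0 h⟩, ?_⟩
  intro i hi x t hx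
  have hDpos : D ≠ 0 := by
    intro h0
    apply hv i hi
    rw [variance, ← hD, h0, div_zero]
  have hunit : ∀ j, (x t ᵥ* (fun c h => Function.extend emb
      (fun i => standardize (m i) c - θ / D) 0 h : Matrix (Chan H N) (Fin 4 × Chan H N) ℝ)) (emb j)
      = ∑ c, standardize (m i) c * standardize (m j) c - θ := by
    intro j
    have h1 := sum_standardize (m i)
    have h2 := sum_standardize (m j)
    simp only [Matrix.vecMul, dotProduct, emb.injective.extend_apply, hx, layerNorm_eq,
      Pi.add_apply, Pi.one_apply, mul_one]
    calc ∑ c, (standardize (m i) c + 1) * (standardize (m j) c - θ / D)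
        = ∑ c, standardize (m i) c * standardize (m j) c + ∑ c, standardize (m j) c
          - θ / D * (∑ c, standardize (m i) c) - ∑ _c : Chan H N, θ / D := by
          rw [Finset.mul_sum, ← Finset.sum_add_distrib, ← Finset.sum_sub_distrib,
            ← Finset.sum_sub_distrib]
          exact Finset.sum_congr rfl fun _ _ => by ring
      _ = _ := by
          rw [h1, h2, Finset.sum_const, Finset.card_univ, nsmul_eq_mul, ← hD]
          field_simp
          ring
  have hself : ∑ c, standardize (m i) c * standardize (m i) c = D := by
    rw [hD, ← sum_standardize_sq (hv i hi)]
    exact Finset.sum_congr rfl fun _ _ => by ring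
  have hshift : tokenShift (0 : Vec H N) x t = x t := by simp [tokenShift, lerp]
  have hpos : 0 < D - θ := by linarith
  funext c
  simp only [ChannelMix.out, hshift]
  refine (Fintype.sum_eq_single (emb i) ?_).trans ?_
  · intro h hne
    beta_reduce
    by_cases hr : ∃ j, emb j = h
    · obtain ⟨j, rfl⟩ := hr
      have hij : i ≠ j := fun e => hne (by rw [e])
      rw [hunit, emb.injective.extend_apply]
      split_ifs with hj
      · rw [max_eq_right (by linarith [hθ i hi j hj hij])]
        simp
      · simp
    · rw [Function.extend_apply' _ _ _ hr]
      simp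
  · beta_reduce
    rw [hunit, hself, emb.injective.extend_apply, if_pos hi, max_eq_left hpos.le]
    field_simp

/-! ### Channels carrying finite information -/

theorem mean_comp_equiv {ι κ : Type} [Fintype ι] [Fintype κ] (e : ι ≃ κ) (x : κ → ℝ) :
    mean (fun i => x (e i)) = mean x := by
  simp only [mean, e.sum_comp x, Fintype.card_congr e]

theorem variance_comp_equiv {ι κ : Type} [Fintype ι] [Fintype κ] (e : ι ≃ κ) (x : κ → ℝ) :
    variance (fun i => x (e i)) = variance x := by
  simp only [variance, mean_comp_equiv, e.sum_comp (fun k => (x k - mean x) ^ 2),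
    Fintype.card_congr e]

theorem standardize_comp_equiv {ι κ : Type} [Fintype ι] [Fintype κ] (e : ι ≃ κ) (x : κ → ℝ) :
    standardize (fun i => x (e i)) = fun i => standardize x (e i) := by
  funext i
  simp only [standardize, mean_comp_equiv, variance_comp_equiv]

theorem variance_eq_sub {ι : Type} [Fintype ι] (x : ι → ℝ) :
    variance x = (∑ i, x i ^ 2) / Fintype.card ι - mean x ^ 2 := by
  rcases isEmpty_or_nonempty ι with h | h
  · simp [variance, mean]
  · have hc : (Fintype.card ι : ℝ) ≠ 0 := by exact_mod_cast Fintype.card_ne_zero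
    have h1 : ∑ i, (x i - mean x) ^ 2
        = ∑ i, x i ^ 2 - 2 * mean x * ∑ i, x i + ∑ _i : ι, mean x ^ 2 := by
      rw [Finset.mul_sum, ← Finset.sum_sub_distrib, ← Finset.sum_add_distrib]
      exact Finset.sum_congr rfl fun _ _ => by ring
    have h2 : ∑ i, x i = Fintype.card ι * mean x := by
      rw [mean]; field_simp
    rw [variance, h1, h2, Finset.sum_const, Finset.card_univ, nsmul_eq_mul]
    field_simp
    ring

/-- Names for the channels of the construction: two channels for every element of the finite
type `I` of possible contents of the residual stream, two channels for every value pattern, and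
the channels `K` of the keys. -/
abbrev Coord (I R K : Type) : Type := (I × Bool) ⊕ (R × Bool) ⊕ K

section Coord

variable {I R K : Type}

open Classical in
/-- Two copies of the one-hot code of `i`. -/
def code (i : I) : Coord I R K → ℝ
  | .inl (j, _) => if j = i then 1 else 0
  | .inr _ => 0

/-- The combination, with coefficients `y`, of the value patterns; the pattern of `ρ` is the
difference of the unit vectors of its two channels.  All patterns have mean zero. -/
def pattern (y : R → ℝ) : Coord I R K → ℝ
  | .inr (.inl (ρ, true)) => y ρ
  | .inr (.inl (ρ, false)) => -y ρ
  | _ => 0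

/-- A vector supported on the channels of the keys. -/
def keyVec (z : K → ℝ) : Coord I R K → ℝ
  | .inr (.inr k) => z k
  | _ => 0

/-- The matrix that sends the first copy of the code of `i` to `f i` and the second to `g i`. -/
def table (f g : I → Coord I R K → ℝ) : Matrix (Coord I R K) (Coord I R K) ℝ
  | .inl (i, false) => f i
  | .inl (i, true) => g i
  | .inr _ => 0

/-- The indicator of the channels of the second copy of the code. -/
def secondCopy : Coord I R K → ℝ
  | .inl (_, true) => 1
  | _ => 0

theorem pattern_add (y z : R → ℝ) :
    (pattern (y + z) : Coord I R K → ℝ) = pattern y + pattern z := by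
  funext x
  rcases x with x | ⟨ρ, _ | _⟩ | k <;> simp [pattern]
  ring

theorem pattern_smul (a : ℝ) (y : R → ℝ) :
    (pattern (a • y) : Coord I R K → ℝ) = a • pattern y := by
  funext x
  rcases x with x | ⟨ρ, _ | _⟩ | k <;> simp [pattern]

theorem pattern_zero : (pattern (0 : R → ℝ) : Coord I R K → ℝ) = 0 := by
  funext x
  rcases x with x | ⟨ρ, _ | _⟩ | k <;> simp [pattern]

variable [Fintype I] [Fintype R] [Fintype K]

/-- The head size of the construction, which uses a single head. -/
def dim (I R K : Type) [Fintype I] [Fintype R] [Fintype K] : ℕ := Fintype.card (Coord I R K)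

/-- The name of a channel within its head. -/
def headName : Fin (dim I R K) ≃ Coord I R K := (Fintype.equivFin (Coord I R K)).symm

/-- The name of a channel. -/
def chanName : Chan 1 (dim I R K) ≃ Coord I R K :=
  (Equiv.uniqueProd (Fin (dim I R K)) (Fin 1)).trans headName

theorem chanName_apply (c : Chan 1 (dim I R K)) : chanName c = headName c.2 := rfl

/-- The activation with the given value in every named channel. -/
def vec (f : Coord I R K → ℝ) : Vec 1 (dim I R K) := fun c => f (chanName c)

theorem headPart_vec (f : Coord I R K → ℝ) (h : Fin 1) :
    headPart (vec f) h = fun i => f (headName i) := rfl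

theorem vec_add (f g : Coord I R K → ℝ) : vec (f + g) = vec f + vec g := rfl

theorem vec_smul (a : ℝ) (f : Coord I R K → ℝ) : vec (a • f) = a • vec f := rfl

theorem vec_dotProduct (f g : Coord I R K → ℝ) : vec f ⬝ᵥ vec g = f ⬝ᵥ g :=
  chanName.sum_comp fun x => f x * g x

theorem vec_vecMul (f : Coord I R K → ℝ) (W : Matrix (Coord I R K) (Coord I R K) ℝ) :
    vec f ᵥ* W.submatrix chanName chanName = vec (f ᵥ* W) := by
  funext c
  simp only [vec, Matrix.vecMul, dotProduct, Matrix.submatrix_apply]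
  exact chanName.sum_comp fun x => f x * W x (chanName c)

theorem sum_pattern (y : R → ℝ) : ∑ x, (pattern y : Coord I R K → ℝ) x = 0 := by
  simp [Fintype.sum_sum_type, Fintype.sum_prod_type, pattern]

theorem sum_pattern_sq (y : R → ℝ) :
    ∑ x, (pattern y : Coord I R K → ℝ) x ^ 2 = 2 * ∑ ρ, y ρ ^ 2 := by
  simp only [Fintype.sum_sum_type, Fintype.sum_prod_type, pattern, Fintype.sum_bool]
  simp [Finset.mul_sum, two_mul]

theorem keyVec_dotProduct (y z : K → ℝ) :
    (keyVec y : Coord I R K → ℝ) ⬝ᵥ keyVec z = y ⬝ᵥ z := by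
  simp [dotProduct, Fintype.sum_sum_type, keyVec]

theorem sum_code (i : I) : ∑ x, (code i : Coord I R K → ℝ) x = 2 := by
  classical
  simp only [Fintype.sum_sum_type, Fintype.sum_prod_type, code, Fintype.sum_bool]
  simp [Finset.sum_add_distrib]
  norm_num

theorem sum_code_sq (i : I) : ∑ x, (code i : Coord I R K → ℝ) x ^ 2 = 2 := by
  rw [← sum_code (R := R) (K := K) i]
  refine Finset.sum_congr rfl fun x _ => ?_
  rcases x with ⟨j, b⟩ | x <;> simp [code]

/-- With the second copy of the code delayed, `table f g` reads off `f` of the current and `g` of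
the previous content. -/
theorem shifted_code_vecMul_table (i j : I) (s : ℝ) (f g : I → Coord I R K → ℝ) :
    (fun x => code i x * (1 - secondCopy x) + s * code j x * secondCopy x) ᵥ* table f g
      = f i + s • g j := by
  classical
  funext y
  simp only [Matrix.vecMul, dotProduct, Fintype.sum_sum_type, Fintype.sum_prod_type, code,
    Fintype.sum_bool, table, secondCopy]
  simp [Finset.sum_add_distrib, add_comm]

theorem code_vecMul_table (i : I) (f g : I → Coord I R K → ℝ) :
    code i ᵥ* table f g = f i + g i := by
  have := shifted_code_vecMul_table i i 1 f g
  rw [one_smul] at this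
  rw [← this]
  congr 1
  funext x
  ring

theorem code_dotProduct (i : I) (g : Coord I R K → ℝ) :
    code i ⬝ᵥ g = g (.inl (i, true)) + g (.inl (i, false)) := by
  classical
  simp only [dotProduct, Fintype.sum_sum_type, Fintype.sum_prod_type, code, Fintype.sum_bool]
  simp [Finset.sum_add_distrib]

/-- The mean of every code. -/
def codeMean (I R K : Type) [Fintype I] [Fintype R] [Fintype K] : ℝ := 2 / dim I R K

/-- The variance of every code. -/
def codeVariance (I R K : Type) [Fintype I] [Fintype R] [Fintype K] : ℝ :=
  2 / dim I R K - codeMean I R K ^ 2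

theorem mean_vec (f : Coord I R K → ℝ) : mean (vec f) = mean f := mean_comp_equiv chanName f

theorem variance_vec (f : Coord I R K → ℝ) : variance (vec f) = variance f :=
  variance_comp_equiv chanName f

theorem mean_code (i : I) : mean (code i : Coord I R K → ℝ) = codeMean I R K := by
  rw [mean, sum_code]; rfl

theorem variance_code (i : I) : variance (code i : Coord I R K → ℝ) = codeVariance I R K := by
  rw [variance_eq_sub, sum_code_sq, mean_code]; rfl

theorem variance_code_add_pattern_ne_zero [Nonempty K] (i : I) (y : R → ℝ) :
    variance (code i + pattern y : Coord I R K → ℝ) ≠ 0 := by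
  apply variance_ne_zero_of_ne (i := .inl (i, true)) (j := .inr (.inr (Classical.arbitrary K)))
  simp [code, pattern]

theorem variance_code_ne_zero [Nonempty K] (i : I) :
    variance (code i : Coord I R K → ℝ) ≠ 0 := by
  have := variance_code_add_pattern_ne_zero (K := K) i (0 : R → ℝ)
  rwa [pattern_zero, add_zero] at this

/-- The normalization that fixes all codes. -/
def codeNorm : Affine (Chan 1 (dim I R K)) :=
  ⟨fun _ => Real.sqrt (codeVariance I R K), fun _ => codeMean I R K⟩

theorem layerNorm_codeNorm [Nonempty K] (i : I) :
    layerNorm codeNorm (vec (code i : Coord I R K → ℝ)) = vec (code i) :=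
  layerNorm_eq_self (by rw [variance_vec]; exact variance_code_ne_zero i)
    (by rw [variance_vec, variance_code]) (by rw [mean_vec, mean_code])

/-- A code plus a pattern can be recovered from its normalization: the channels of the keys
determine the shift, and the code determines the scale. -/
theorem eq_of_standardize_code_add_pattern_eq [Nonempty K] {i j : I} {y z : R → ℝ}
    (h : standardize (vec (code i + pattern y : Coord I R K → ℝ))
      = standardize (vec (code j + pattern z : Coord I R K → ℝ))) : i = j ∧ y = z := by
  obtain ⟨c, hc, b, hb⟩ := exists_affine_of_standardize_eq
    (by rw [variance_vec]; exact variance_code_add_pattern_ne_zero i y)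
    (by rw [variance_vec]; exact variance_code_add_pattern_ne_zero j z) h
  have hb' : ∀ x, (code i + pattern y : Coord I R K → ℝ) x =
      c * (code j + pattern z : Coord I R K → ℝ) x + b := by
    intro x
    have := hb (chanName.symm x)
    simpa [vec] using this
  have h0 : b = 0 := by
    have := hb' (.inr (.inr (Classical.arbitrary K)))
    simpa [code, pattern] using this.symm
  subst h0
  have hij : i = j := by
    have := hb' (.inl (i, true))
    by_contra hne
    simp [code, pattern, hne] at this
  subst hij
  have h1 : c = 1 := by
    have := hb' (.inl (i, true))
    simpa [code, pattern] using this.symm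
  subst h1
  refine ⟨rfl, ?_⟩
  funext ρ
  have := hb' (.inr (.inl (ρ, true)))
  simpa [code, pattern] using this

/-- Normalized coefficients of a combination of patterns. -/
def unitCoeff (I K : Type) [Fintype I] [Fintype K] (y : R → ℝ) : R → ℝ :=
  (Real.sqrt (dim I R K) / Real.sqrt (2 * ∑ ρ, y ρ ^ 2)) • y

theorem standardize_pattern (y : R → ℝ) :
    standardize (pattern y : Coord I R K → ℝ) = pattern (unitCoeff I K y) := by
  rw [standardize_of_mean_eq_zero (sum_pattern y), sum_pattern_sq, unitCoeff, pattern_smul]; rfl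

theorem variance_pattern_ne_zero {y : R → ℝ} (hy : y ≠ 0) :
    variance (pattern y : Coord I R K → ℝ) ≠ 0 := by
  obtain ⟨ρ, hρ⟩ := Function.ne_iff.1 hy
  apply variance_ne_zero_of_ne (i := .inr (.inl (ρ, true))) (j := .inr (.inl (ρ, false)))
  simp only [pattern]
  intro h
  apply hρ
  simp only [Pi.zero_apply]
  linarith

theorem unitCoeff_smul {c : ℝ} (hc : 0 < c) (y : R → ℝ) :
    unitCoeff I K (c • y) = unitCoeff I K y := by
  unfold unitCoeff
  have h1 : 2 * ∑ ρ, (c • y) ρ ^ 2 = c ^ 2 * (2 * ∑ ρ, y ρ ^ 2) := by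
    simp only [Pi.smul_apply, smul_eq_mul, mul_pow, ← Finset.mul_sum]
    ring
  rw [h1, Real.sqrt_mul (sq_nonneg c), Real.sqrt_sq hc.le, smul_smul]
  congr 1
  rw [mul_comm c, div_mul_eq_mul_div]
  exact mul_div_mul_right _ _ hc.ne'

theorem exists_unitCoeff_eq_smul {y : R → ℝ} (hy : y ≠ 0) :
    ∃ c : ℝ, 0 < c ∧ unitCoeff I K y = c • y := by
  obtain ⟨ρ, hρ⟩ := Function.ne_iff.1 hy
  refine ⟨Real.sqrt (dim I R K) / Real.sqrt (2 * ∑ ρ, y ρ ^ 2),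
    div_pos (Real.sqrt_pos.2 ?_) (Real.sqrt_pos.2 ?_), rfl⟩
  · have : Nonempty (Coord I R K) := ⟨.inr (.inl (ρ, true))⟩
    exact_mod_cast Fintype.card_pos (α := Coord I R K)
  · have : 0 < ∑ ρ, y ρ ^ 2 :=
      Finset.sum_pos' (fun _ _ => sq_nonneg _)
        ⟨ρ, Finset.mem_univ _, by have : y ρ ≠ 0 := hρ; positivity⟩
    positivity

end Coord

/-! ### A time-mixing module driven by finite information -/

section TimeMixing

variable {I R K : Type} [Fintype I] [Fintype R] [Fintype K]

/-- The constant decay of the construction. -/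
def rate : ℝ := Real.exp (-Real.exp (-0.5) * Real.sigmoid 0)

/-- A low-rank MLP with output zero. -/
def zeroLora (H N : ℕ) : Lora H N := ⟨0, 0, 0⟩

theorem zeroLora_apply {H N : ℕ} (f : ℝ → ℝ) (x : Vec H N) : (zeroLora H N).apply f x = 0 := by
  funext c
  exact Fintype.sum_empty (ι := Fin 0) fun j => f ((x ᵥ* (0 : Matrix (Chan H N) (Fin 0) ℝ)) j) * 0

/-- A low-rank MLP whose output is one if the activation is the sigmoid. -/
def oneLora (H N : ℕ) : Lora H N := ⟨1, 0, fun _ _ => 2⟩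

theorem oneLora_apply {H N : ℕ} (x : Vec H N) : (oneLora H N).apply Real.sigmoid x = 1 := by
  funext c
  change ∑ j : Fin 1, Real.sigmoid ((x ᵥ* (0 : Matrix (Chan H N) (Fin 1) ℝ)) j) * 2 = 1
  simp [Real.sigmoid_zero]

/-- A time-mixing module with constant decay and constant in-context learning rate `sigmoid b`.
While the stream carries the code of `i`, the key is `kf i`, the receptance is `rf i`, and the
value precursor has the pattern coefficients `vf i`, plus `vg j` if the stream carried the code of
`j` at the previous position.  Removal key and replacement key coincide, gate and output matrix are
trivial, and `bw` is the weight of the bonus. -/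
def codeTimeMix (kf rf : I → K → ℝ) (vf vg : I → R → ℝ) (b bw : ℝ) : TimeMix 1 (dim I R K) where
  μr := 0
  μk := 0
  μv := vec secondCopy
  μd := 0
  μa := 0
  μg := 0
  Wr := (table (fun i => keyVec (rf i)) 0).submatrix chanName chanName
  Wk := (table (fun i => keyVec (kf i)) 0).submatrix chanName chanName
  Wv := (table (fun i => pattern (vf i)) (fun i => pattern (vg i))).submatrix chanName chanName
  Wo := 1
  loraA := zeroLora _ _
  loraNu := zeroLora _ _
  loraD := zeroLora _ _
  loraG := oneLora _ _
  biasA := fun _ => b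
  biasNu := 0
  biasD := 0
  ξ := 1
  α := 0
  ρ := fun _ => bw
  headNorm := ⟨1, 0⟩

/-- `z` is the sequence of states, one row for each value pattern, that results from the keys `k`
and the value coefficients `c` in the first `n` steps.  For a key zero, the quotient here and the
normalized removal key of the model both have the junk value zero. -/
def IsStateSeq (a : ℝ) (n : ℕ) (k : ℕ → K → ℝ) (c : ℕ → R → ℝ) (z : ℕ → R → K → ℝ) : Prop :=
  z 0 = 0 ∧ ∀ t < n, ∀ ρ,
    z (t + 1) ρ = rate • z t ρ - (a * (z t ρ ⬝ᵥ k t / (k t ⬝ᵥ k t))) • k t + c t ρ • k t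

variable {kf rf : I → K → ℝ} {vf vg : I → R → ℝ} {b bw : ℝ} {n : ℕ} {i : ℕ → I}
  {x : ℕ → Vec 1 (dim I R K)} {v0 : Option (ℕ → Vec 1 (dim I R K))} {c : ℕ → R → ℝ}
  {z : ℕ → R → K → ℝ} {t : ℕ}

theorem key_codeTimeMix (hx : x t = vec (code (i t))) :
    (codeTimeMix kf rf vf vg b bw).key x t = vec (keyVec (kf (i t))) := by
  have : tokenShift (codeTimeMix kf rf vf vg b bw).μk x t = vec (code (i t)) := by
    simp [tokenShift, lerp, codeTimeMix, hx]
  rw [TimeMix.key, this]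
  simp only [codeTimeMix]
  rw [vec_vecMul, code_vecMul_table, Pi.zero_apply, add_zero]

theorem receptance_codeTimeMix (hx : x t = vec (code (i t))) :
    (codeTimeMix kf rf vf vg b bw).receptance x t = vec (keyVec (rf (i t))) := by
  have : tokenShift (codeTimeMix kf rf vf vg b bw).μr x t = vec (code (i t)) := by
    simp [tokenShift, lerp, codeTimeMix, hx]
  rw [TimeMix.receptance, this]
  simp only [codeTimeMix]
  rw [vec_vecMul, code_vecMul_table, Pi.zero_apply, add_zero]

theorem valuePre_codeTimeMix (hx : ∀ s ≤ t, x s = vec (code (i s))) :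
    (codeTimeMix kf rf vf vg b bw).valuePre x t
      = vec (pattern (vf (i t) + (if t = 0 then 0 else 1 : ℝ) • vg (i (t - 1)))) := by
  have : tokenShift (codeTimeMix kf rf vf vg b bw).μv x t
      = vec (fun y => code (i t) y * (1 - secondCopy y)
          + (if t = 0 then 0 else 1 : ℝ) * code (i (t - 1)) y * secondCopy y) := by
    funext y
    rcases t with _ | t
    · simp [tokenShift, lerp, codeTimeMix, hx 0 le_rfl, shift, vec]
      ring
    · simp [tokenShift, lerp, codeTimeMix, hx (t + 1) le_rfl, hx t (by omega), shift, vec]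
      ring
  rw [TimeMix.valuePre, this]
  simp only [codeTimeMix]
  rw [vec_vecMul, shifted_code_vecMul_table, pattern_add, pattern_smul]

theorem iclr_codeTimeMix (ch : Chan 1 (dim I R K)) :
    (codeTimeMix kf rf vf vg b bw).iclr x t ch = Real.sigmoid b := by
  simp [TimeMix.iclr, codeTimeMix, zeroLora_apply]

theorem valueGate_codeTimeMix (ch : Chan 1 (dim I R K)) :
    (codeTimeMix kf rf vf vg b bw).valueGate x t ch = 1 / 2 := by
  simp [TimeMix.valueGate, codeTimeMix, zeroLora_apply, Real.sigmoid_zero]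

theorem decay_codeTimeMix (ch : Chan 1 (dim I R K)) :
    (codeTimeMix kf rf vf vg b bw).decay x t ch = rate := by
  simp [TimeMix.decay, TimeMix.decayPre, codeTimeMix, zeroLora_apply, rate]

theorem gate_codeTimeMix : (codeTimeMix kf rf vf vg b bw).gate x t = 1 := by
  funext ch
  simp [TimeMix.gate, codeTimeMix, oneLora_apply]

theorem removalKey_codeTimeMix (hx : x t = vec (code (i t))) :
    (codeTimeMix kf rf vf vg b bw).removalKey x t = vec (keyVec (kf (i t))) := by
  rw [TimeMix.removalKey, key_codeTimeMix hx]
  simp [codeTimeMix]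

theorem replacementKey_codeTimeMix (hx : x t = vec (code (i t))) :
    (codeTimeMix kf rf vf vg b bw).replacementKey x t = vec (keyVec (kf (i t))) := by
  rw [TimeMix.replacementKey, key_codeTimeMix hx]
  simp [codeTimeMix, lerp]

/-- In the first layer the value is its precursor. -/
theorem value_codeTimeMix_none (hx : ∀ s ≤ t, x s = vec (code (i s))) :
    (codeTimeMix kf rf vf vg b bw).value x none t
      = vec (pattern (vf (i t) + (if t = 0 then 0 else 1 : ℝ) • vg (i (t - 1)))) :=
  valuePre_codeTimeMix hx

/-- In later layers the value is the average of its precursors in the first and in the present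
layer. -/
theorem value_codeTimeMix_some {v : ℕ → Vec 1 (dim I R K)} {c₀ : R → ℝ}
    (hx : ∀ s ≤ t, x s = vec (code (i s))) (hv : v t = vec (pattern c₀)) :
    (codeTimeMix kf rf vf vg b bw).value x (some v) t = vec (pattern ((1 / 2 : ℝ) •
      (c₀ + vf (i t) + (if t = 0 then 0 else 1 : ℝ) • vg (i (t - 1))))) := by
  funext ch
  simp only [TimeMix.value, lerp, Pi.add_apply, Pi.mul_apply, Pi.sub_apply,
    valueGate_codeTimeMix, hv, valuePre_codeTimeMix hx, pattern_smul, add_assoc, vec_smul,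
    Pi.smul_apply, smul_eq_mul]
  rw [pattern_add c₀, vec_add, Pi.add_apply]
  ring

theorem norm2_headPart_keyVec (k : K → ℝ) (h : Fin 1) :
    norm2 (headPart (vec (keyVec k : Coord I R K → ℝ)) h) = Real.sqrt (k ⬝ᵥ k) := by
  rw [norm2, headPart_vec, headName.sum_comp fun y => (keyVec k : Coord I R K → ℝ) y ^ 2,
    ← keyVec_dotProduct (I := I) (R := R)]
  simp only [dotProduct, sq]

theorem wkv_codeTimeMix (hx : ∀ s < n, x s = vec (code (i s)))
    (hv : ∀ s < n, (codeTimeMix kf rf vf vg b bw).value x v0 s = vec (pattern (c s)))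
    (hz : IsStateSeq (Real.sigmoid b) n (fun s => kf (i s)) c z) (h : Fin 1) (ht : t ≤ n) :
    (codeTimeMix kf rf vf vg b bw).wkv x v0 h t = Matrix.of fun p q =>
      pattern (I := I) (fun ρ => (keyVec (z t ρ) : Coord I R K → ℝ) (headName q))
        (headName p) := by
  induction t with
  | zero =>
    have : (fun (q : Coord I R K) (ρ : R) => (keyVec (z 0 ρ) : Coord I R K → ℝ) q) = 0 := by
      funext q ρ
      rcases q with q | q | q <;> simp [keyVec, hz.1]
    ext p q
    have h2 : (fun ρ => (keyVec (z 0 ρ) : Coord I R K → ℝ) (headName q)) = 0 :=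
      congrFun this (headName q)
    rw [Matrix.of_apply, h2, pattern_zero]
    rfl
  | succ t ih =>
    have htn : t < n := ht
    set k := kf (i t) with hk
    have hkey := removalKey_codeTimeMix (kf := kf) (rf := rf) (vf := vf) (vg := vg) (b := b)
      (bw := bw) (hx t htn)
    have hhat : ∀ q, headPart ((codeTimeMix kf rf vf vg b bw).removalKeyHat x t) h q
        = (keyVec k : Coord I R K → ℝ) (headName q) / Real.sqrt (k ⬝ᵥ k) := by
      intro q
      simp only [headPart, TimeMix.removalKeyHat, hkey, norm2_headPart_keyVec]
      rfl
    have hkk : 0 ≤ k ⬝ᵥ k := by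
      simp only [dotProduct]; exact Finset.sum_nonneg fun _ _ => mul_self_nonneg _
    have htr : (codeTimeMix kf rf vf vg b bw).transition x t h = rate • 1 -
        (Real.sigmoid b / (k ⬝ᵥ k)) • Matrix.vecMulVec
          (fun q => (keyVec k : Coord I R K → ℝ) (headName q))
          (fun q => (keyVec k : Coord I R K → ℝ) (headName q)) := by
      ext p q
      simp only [TimeMix.transition, Matrix.sub_apply, Matrix.vecMulVec_apply, Matrix.smul_apply,
        hhat, smul_eq_mul, Matrix.diagonal_apply, Matrix.one_apply]
      congr 1
      · by_cases hpq : p = q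
        · simp [hpq, headPart, decay_codeTimeMix]
        · simp [hpq]
      · have : headPart ((codeTimeMix kf rf vf vg b bw).iclr x t *
            (codeTimeMix kf rf vf vg b bw).removalKeyHat x t) h q
            = Real.sigmoid b * headPart ((codeTimeMix kf rf vf vg b bw).removalKeyHat x t) h q := by
          simp only [headPart, Pi.mul_apply, iclr_codeTimeMix]
        rw [this, hhat]
        have h3 : Real.sqrt (k ⬝ᵥ k) * Real.sqrt (k ⬝ᵥ k) = k ⬝ᵥ k := Real.mul_self_sqrt hkk
        calc _ = Real.sigmoid b * (keyVec k (headName p) * keyVec k (headName q))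
              / (Real.sqrt (k ⬝ᵥ k) * Real.sqrt (k ⬝ᵥ k)) := by
              rw [mul_div_assoc, ← div_mul_div_comm]; ring
          _ = _ := by rw [h3]; ring
    rw [TimeMix.wkv, ih htn.le, htr, hv t htn, replacementKey_codeTimeMix (hx t htn)]
    ext p q
    have hsum : ((Matrix.of fun p q =>
        pattern (I := I) (fun ρ => (keyVec (z t ρ) : Coord I R K → ℝ) (headName q)) (headName p)) *
        (Matrix.vecMulVec
          (fun q => (keyVec k : Coord I R K → ℝ) (headName q))
          (fun q => (keyVec k : Coord I R K → ℝ) (headName q)))) p q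
        = (pattern (fun ρ => z t ρ ⬝ᵥ k) : Coord I R K → ℝ) (headName p)
          * keyVec k (headName q) := by
      simp only [Matrix.mul_apply, Matrix.of_apply, Matrix.vecMulVec_apply, ← mul_assoc,
        ← Finset.sum_mul]
      congr 1
      rw [headName.sum_comp fun y =>
        pattern (I := I) (fun ρ => (keyVec (z t ρ) : Coord I R K → ℝ) y) (headName p)
          * keyVec k y]
      rcases headName p with y | ⟨ρ, _ | _⟩ | y
      · simp [pattern]
      · simp only [pattern, neg_mul, Finset.sum_neg_distrib]
        rw [← keyVec_dotProduct (I := I) (R := R)]; rfl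
      · simp only [pattern]
        rw [← keyVec_dotProduct (I := I) (R := R)]; rfl
      · simp [pattern]
    rw [Matrix.mul_sub, Matrix.mul_smul, Matrix.mul_smul, Matrix.mul_one]
    simp only [Matrix.add_apply, Matrix.sub_apply, Matrix.smul_apply, hsum, smul_eq_mul,
      Matrix.vecMulVec_apply, headPart_vec, Matrix.of_apply]
    have hstep := hz.2 t htn
    simp only [← hk] at hstep ⊢
    rcases headName p with y | ⟨ρ, _ | _⟩ | y <;> rcases headName q with y' | y' | y' <;>
      simp [pattern, keyVec, hstep] <;> ring

/-- The coefficients of the readout. -/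
def readCoeff (rf : I → K → ℝ) (i : ℕ → I) (z : ℕ → R → K → ℝ) (t : ℕ) : R → ℝ :=
  fun ρ => rf (i t) ⬝ᵥ z (t + 1) ρ

theorem readout_codeTimeMix (hx : ∀ s < n, x s = vec (code (i s)))
    (hv : ∀ s < n, (codeTimeMix kf rf vf vg b bw).value x v0 s = vec (pattern (c s)))
    (hz : IsStateSeq (Real.sigmoid b) n (fun s => kf (i s)) c z) (ht : t < n) :
    (codeTimeMix kf rf vf vg b bw).readout x v0 t = vec (pattern (readCoeff rf i z t)) := by
  funext ch
  simp only [TimeMix.readout, receptance_codeTimeMix (hx t ht),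
    wkv_codeTimeMix hx hv hz ch.1 (Nat.succ_le_of_lt ht), Matrix.vecMul, dotProduct,
    headPart_vec, Matrix.transpose_apply, Matrix.of_apply]
  rw [headName.sum_comp fun y => (keyVec (rf (i t)) : Coord I R K → ℝ) y *
    pattern (I := I) (fun ρ => (keyVec (z (t + 1) ρ) : Coord I R K → ℝ) y) (headName ch.2)]
  simp only [vec, chanName_apply]
  rcases headName ch.2 with y | ⟨ρ, _ | _⟩ | y
  · simp [pattern]
  · simp only [pattern, mul_neg, Finset.sum_neg_distrib, readCoeff]
    rw [← keyVec_dotProduct (I := I) (R := R)]; rfl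
  · simp only [pattern, readCoeff]
    rw [← keyVec_dotProduct (I := I) (R := R)]; rfl
  · simp [pattern]

theorem out_codeTimeMix (hx : ∀ s < n, x s = vec (code (i s)))
    (hv : ∀ s < n, (codeTimeMix kf rf vf vg b bw).value x v0 s = vec (pattern (c s)))
    (hz : IsStateSeq (Real.sigmoid b) n (fun s => kf (i s)) c z) (ht : t < n) :
    (codeTimeMix kf rf vf vg b bw).out x v0 t
      = vec (pattern (unitCoeff I K (readCoeff rf i z t)
          + (bw * (rf (i t) ⬝ᵥ kf (i t))) • c t)) := by
  rw [TimeMix.out, gate_codeTimeMix, readout_codeTimeMix hx hv hz ht, one_mul]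
  have hWo : (codeTimeMix kf rf vf vg b bw).Wo = 1 := rfl
  rw [hWo, Matrix.vecMul_one, pattern_add, vec_add]
  congr 1
  · funext ch
    have : groupNorm (codeTimeMix kf rf vf vg b bw).headNorm
        (vec (pattern (readCoeff rf i z t))) ch
        = standardize (fun q => (pattern (readCoeff rf i z t) : Coord I R K → ℝ) (headName q)) ch.2
          := by
      simp [groupNorm, layerNorm_eq, codeTimeMix, headPart, headPart_vec]
    rw [this, standardize_comp_equiv, standardize_pattern]
    rfl
  · funext ch
    simp only [TimeMix.bonus, receptance_codeTimeMix (hx t ht), hv t ht, pattern_smul, vec_smul,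
      Pi.smul_apply, smul_eq_mul]
    congr 1
    rw [← keyVec_dotProduct (I := I) (R := R) (K := K)]
    simp only [dotProduct, Finset.mul_sum]
    refine (Finset.sum_congr rfl fun q _ => ?_).trans (headName.sum_comp fun y => bw *
      ((keyVec (rf (i t)) : Coord I R K → ℝ) y * keyVec (kf (i t)) y))
    simp only [headPart, Pi.mul_apply, replacementKey_codeTimeMix (hx t ht)]
    simp only [codeTimeMix, vec, chanName_apply]
    ring

end TimeMixing

/-! ### Layers and models that update finite information -/

section Update

variable {I R K : Type} [Fintype I] [Fintype R] [Fintype K]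

/-- The value coefficients at position `t`, when the stream carries the codes of `i`: `cur` of the
current content plus `prev` of the previous one. -/
def valueCoeff (cur prev : I → R → ℝ) (i : ℕ → I) (t : ℕ) : R → ℝ :=
  cur (i t) + (if t = 0 then 0 else 1 : ℝ) • prev (i (t - 1))

/-- What a layer of the construction does: the functions of the content of the stream that serve
as key, receptance and value coefficients, the in-context learning rate and the bonus weight, and
the new contents of the stream.  A new content in `target` determines the content `old` which it
replaces and the coefficients `coeff` of the output of the time-mixing module, and is determined by
them. -/
structure Update (I R K : Type) where
  (key read : I → K → ℝ)
  (cur prev : I → R → ℝ)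
  (learn bonus : ℝ)
  target : Set I
  old : I → I
  coeff : I → R → ℝ
  learn_pos : 0 < learn
  learn_lt_one : learn < 1
  inj : ∀ i ∈ target, ∀ j ∈ target, old i = old j → coeff i = coeff j → i = j

namespace Update

/-- The update turns the contents `i` of the stream into `i'` at the first `n` positions, and
divides only by nonzero numbers. -/
def Runs (U : Update I R K) (n : ℕ) (i i' : ℕ → I) : Prop :=
  ∃ z, IsStateSeq U.learn n (fun s => U.key (i s)) (valueCoeff U.cur U.prev i) z ∧
    ∀ t < n, i' t ∈ U.target ∧ U.old (i' t) = i t ∧ U.key (i t) ≠ 0 ∧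
      readCoeff U.read i z t ≠ 0 ∧
      U.coeff (i' t) = unitCoeff I K (readCoeff U.read i z t) +
        (U.bonus * (U.read (i t) ⬝ᵥ U.key (i t))) • valueCoeff U.cur U.prev i t

theorem exists_layer [Nonempty K] (U : Update I R K) (vf vg : I → R → ℝ) :
    ∃ l : Layer 1 (dim I R K), l.normTime = codeNorm ∧
      (∃ b, l.timeMix = codeTimeMix U.key U.read vf vg b U.bonus) ∧
      ∀ n i i' x v0, U.Runs n i i' → (∀ t < n, x t = vec (code (i t))) →
        (∀ t < n, l.timeMix.value (l.timeIn x) v0 t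
          = vec (pattern (valueCoeff U.cur U.prev i t))) →
        ∀ t < n, l.Regular v0 x t ∧ l.out v0 x t = vec (code (i' t)) := by
  obtain ⟨b, hb⟩ : ∃ b, Real.sigmoid b = U.learn := by
    have : U.learn ∈ Set.range Real.sigmoid := by
      rw [Real.range_sigmoid]; exact ⟨U.learn_pos, U.learn_lt_one⟩
    exact this
  obtain ⟨cm, hcm⟩ := exists_channelMix_lookup (I := I)
    ⟨fun i => (0, chanName.symm (.inl (i, true))), fun i j h => by simpa using h⟩ U.target
    (fun i => vec (code (U.old i) + pattern (U.coeff i) : Coord I R K → ℝ))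
    (fun i => vec (code i) - vec (code (U.old i) + pattern (U.coeff i)))
    (fun i _ => by rw [variance_vec]; exact variance_code_add_pattern_ne_zero _ _)
    (fun i hi j hj h => by
      obtain ⟨h1, h2⟩ := eq_of_standardize_code_add_pattern_eq h
      exact U.inj i hi j hj h1 h2)
  refine ⟨⟨codeNorm, codeTimeMix U.key U.read vf vg b U.bonus, ⟨1, 1⟩, cm⟩, rfl, ⟨b, rfl⟩, ?_⟩
  rintro n i i' x v0 ⟨z, hz, hrun⟩ hx hv t ht
  obtain ⟨h1, h2, h3, h4, h5⟩ := hrun t ht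
  set l : Layer 1 (dim I R K) :=
    ⟨codeNorm, codeTimeMix U.key U.read vf vg b U.bonus, ⟨1, 1⟩, cm⟩ with hl
  have hin : ∀ s < n, l.timeIn x s = vec (code (i s)) := fun s hs => by
    rw [Layer.timeIn, hx s hs]; exact layerNorm_codeNorm _
  have hz' : IsStateSeq (Real.sigmoid b) n (fun s => U.key (i s))
      (valueCoeff U.cur U.prev i) z := by
    rwa [hb]
  have hmid : l.mid v0 x t = vec (code (U.old (i' t)) + pattern (U.coeff (i' t))) := by
    rw [Layer.mid, hx t ht, h2, h5, vec_add]
    congr 1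
    exact out_codeTimeMix hin hv hz' ht
  refine ⟨⟨?_, fun h => ⟨?_, ?_⟩, ?_⟩, ?_⟩
  · rw [hx t ht, variance_vec]
    exact variance_code_ne_zero _
  · have : l.timeMix.removalKey (l.timeIn x) t = vec (keyVec (U.key (i t))) :=
      removalKey_codeTimeMix (hin t ht)
    rw [this, norm2_headPart_keyVec]
    refine (Real.sqrt_pos.2 (lt_of_le_of_ne ?_ ?_)).ne'
    · simp only [dotProduct]; exact Finset.sum_nonneg fun _ _ => mul_self_nonneg _
    · exact fun h0 => h3 (dotProduct_self_eq_zero.1 h0.symm)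
  · have : l.timeMix.readout (l.timeIn x) v0 t = vec (pattern (readCoeff U.read i z t)) :=
      readout_codeTimeMix hin hv hz' ht
    rw [this, headPart_vec, variance_comp_equiv]
    exact variance_pattern_ne_zero h4
  · rw [hmid, variance_vec]
    exact variance_code_add_pattern_ne_zero _ _
  · rw [Layer.out, hmid]
    have : l.channelMix.out (l.chanIn v0 x) t = _ := hcm (i' t) h1 (l.chanIn v0 x) t (by
      rw [Layer.chanIn, hmid])
    rw [this]
    abel

theorem exists_first_layer [Nonempty K] (U : Update I R K) :
    ∃ l : Layer 1 (dim I R K), ∀ n i i' x, U.Runs n i i' →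
      (∀ t < n, x t = vec (code (i t))) → ∀ t < n,
        l.Regular none x t ∧ l.out none x t = vec (code (i' t)) ∧
        l.timeMix.valuePre (l.timeIn x) t = vec (pattern (valueCoeff U.cur U.prev i t)) := by
  obtain ⟨l, hnorm, ⟨b, htm⟩, hl⟩ := U.exists_layer U.cur U.prev
  refine ⟨l, fun n i i' x hrun hx t ht => ?_⟩
  have hval : ∀ t < n, l.timeMix.value (l.timeIn x) none t
      = vec (pattern (valueCoeff U.cur U.prev i t)) := fun t ht => by
    rw [htm]
    refine value_codeTimeMix_none (i := i) fun s hs => ?_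
    rw [Layer.timeIn, hnorm, hx s (by omega)]; exact layerNorm_codeNorm _
  obtain ⟨h1, h2⟩ := hl n i i' x none hrun hx hval t ht
  exact ⟨h1, h2, hval t ht⟩

/-- The value precursors of the first layer enter the values of every later layer; if the content
of the stream determines their coefficients as `c₀`, then they can be compensated for. -/
theorem exists_later_layer [Nonempty K] (U : Update I R K) (c₀ : I → R → ℝ) :
    ∃ l : Layer 1 (dim I R K), ∀ n i i' x v, U.Runs n i i' →
      (∀ t < n, x t = vec (code (i t))) → (∀ t < n, v t = vec (pattern (c₀ (i t)))) →
      ∀ t < n, l.Regular (some v) x t ∧ l.out (some v) x t = vec (code (i' t)) := by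
  obtain ⟨l, hnorm, ⟨b, htm⟩, hl⟩ := U.exists_layer
    (fun i => (2 : ℝ) • U.cur i - c₀ i) (fun i => (2 : ℝ) • U.prev i)
  refine ⟨l, fun n i i' x v hrun hx hv => hl n i i' x (some v) hrun hx fun t ht => ?_⟩
  rw [htm]
  refine (value_codeTimeMix_some (i := i) (fun s hs => ?_) (hv t ht)).trans ?_
  · rw [Layer.timeIn, hnorm, hx s (by omega)]; exact layerNorm_codeNorm _
  · congr 2
    rw [add_sub_cancel, valueCoeff, smul_comm _ (2 : ℝ), ← smul_add, smul_smul]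
    norm_num

open Classical in
/-- The output vector that reads off whether the content of the stream belongs to `acc`. -/
def acceptVec (acc : Set I) : Coord I R K → ℝ
  | .inl (i, true) => if i ∈ acc then 1 else 0
  | _ => 0

/-- Four updates that follow one another are the work of a model with four layers. -/
theorem exists_model [Nonempty K] {V : Type*} (U₁ U₂ U₃ U₄ : Update I R K) (c₀ : I → R → ℝ)
    (start : V → I) (acc : Set I) :
    ∃ M : Model V 1 (dim I R K) 4, ∀ (w : List V) (i₀ i₁ i₂ i₃ i₄ : ℕ → I),
      (∀ t < w.length, ∃ v, w[t]? = some v ∧ i₀ t = start v) →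
      U₁.Runs w.length i₀ i₁ → U₂.Runs w.length i₁ i₂ → U₃.Runs w.length i₂ i₃ →
      U₄.Runs w.length i₃ i₄ →
      (∀ t < w.length, valueCoeff U₁.cur U₁.prev i₀ t = c₀ (i₁ t) ∧ c₀ (i₁ t) = c₀ (i₂ t) ∧
        c₀ (i₂ t) = c₀ (i₃ t)) →
      M.Regular w ∧ ∀ t < w.length, (i₄ t ∈ acc → M.output w t = 1) ∧
        (i₄ t ∉ acc → M.output w t = 0) := by
  classical
  obtain ⟨l₁, hl₁⟩ := U₁.exists_first_layer
  obtain ⟨l₂, hl₂⟩ := U₂.exists_later_layer c₀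
  obtain ⟨l₃, hl₃⟩ := U₃.exists_later_layer c₀
  obtain ⟨l₄, hl₄⟩ := U₄.exists_later_layer c₀
  refine ⟨⟨fun v => vec (code (start v)), codeNorm, ![l₁, l₂, l₃, l₄], codeNorm,
    vec (acceptVec acc)⟩, ?_⟩
  intro w i₀ i₁ i₂ i₃ i₄ h₀ r₁ r₂ r₃ r₄ hc
  set M : Model V 1 (dim I R K) 4 := ⟨fun v => vec (code (start v)), codeNorm,
    ![l₁, l₂, l₃, l₄], codeNorm, vec (acceptVec acc)⟩ with hM
  have e0 : ∀ t < w.length, M.embed w t = vec (code (i₀ t)) := fun t ht => by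
    obtain ⟨v, hv, hi⟩ := h₀ t ht
    rw [Model.embed, hv, hi]; rfl
  have s0 : ∀ t < w.length, M.stream w 0 t = vec (code (i₀ t)) := fun t ht => by
    change layerNorm codeNorm (M.embed w t) = _
    rw [e0 t ht, layerNorm_codeNorm]
  have p1 := hl₁ _ i₀ i₁ (M.stream w 0) r₁ s0
  have s1 : ∀ t < w.length, M.stream w 1 t = vec (code (i₁ t)) := fun t ht => (p1 t ht).2.1
  set v : ℕ → Vec 1 (dim I R K) := l₁.timeMix.valuePre (l₁.timeIn (M.stream w 0)) with hv
  have v1 : ∀ t < w.length, v t = vec (pattern (c₀ (i₁ t))) := fun t ht => by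
    rw [← (hc t ht).1]; exact (p1 t ht).2.2
  have v2 : ∀ t < w.length, v t = vec (pattern (c₀ (i₂ t))) := fun t ht => by
    rw [← (hc t ht).2.1]; exact v1 t ht
  have v3 : ∀ t < w.length, v t = vec (pattern (c₀ (i₃ t))) := fun t ht => by
    rw [← (hc t ht).2.2]; exact v2 t ht
  have p2 := hl₂ _ i₁ i₂ (M.stream w 1) v r₂ s1 v1
  have s2 : ∀ t < w.length, M.stream w 2 t = vec (code (i₂ t)) := fun t ht => (p2 t ht).2
  have p3 := hl₃ _ i₂ i₃ (M.stream w 2) v r₃ s2 v2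
  have s3 : ∀ t < w.length, M.stream w 3 t = vec (code (i₃ t)) := fun t ht => (p3 t ht).2
  have p4 := hl₄ _ i₃ i₄ (M.stream w 3) v r₄ s3 v3
  have s4 : ∀ t < w.length, M.stream w 4 t = vec (code (i₄ t)) := fun t ht => (p4 t ht).2
  refine ⟨fun t ht => ⟨?_, fun l => ?_, ?_⟩, fun t ht => ?_⟩
  · rw [e0 t ht, variance_vec]
    exact variance_code_ne_zero _
  · fin_cases l
    · exact (p1 t ht).1
    · exact (p2 t ht).1
    · exact (p3 t ht).1
    · exact (p4 t ht).1
  · rw [s4 t ht, variance_vec]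
    exact variance_code_ne_zero _
  · have hout : M.output w t = if i₄ t ∈ acc then 1 else 0 := by
      rw [Model.output, s4 t ht]
      change layerNorm codeNorm _ ⬝ᵥ _ = _
      rw [layerNorm_codeNorm]
      rw [hM, vec_dotProduct, code_dotProduct]
      simp [acceptVec]
    rw [hout]
    exact ⟨fun h => if_pos h, fun h => if_neg h⟩

end Update

end Update

theorem rate_pos : 0 < rate := Real.exp_pos _

theorem rate_lt_one : rate < 1 := by
  rw [rate, Real.exp_lt_one_iff]
  have := mul_pos (Real.exp_pos (-0.5)) (Real.sigmoid_pos 0)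
  linarith

/-! ### The contents of the residual stream -/

/-- The content of the residual stream at a position, for a word over `T`: the token, whether the
position is the first one, the position modulo some number, the tokens read during the last `m`
steps (`hist d` is the token `d` positions back), and whether the prefix read is accepted.  Entries
that a layer does not know yet have a default value. -/
@[ext]
structure Info (T : Type) (m : ℕ) where
  tok : Option T
  first : Bool
  pos : Fin m
  hist : Fin m → Option T
  acc : Bool

instance {T : Type} {m : ℕ} [Finite T] : Finite (Info T m) :=
  Finite.of_injective (fun i => (i.tok, i.first, i.pos, i.hist, i.acc)) fun i j h => by
    simp only [Prod.mk.injEq] at h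
    exact Info.ext h.1 h.2.1 h.2.2.1 h.2.2.2.1 h.2.2.2.2

instance {T : Type} {m : ℕ} [Finite T] : Fintype (Info T m) := Fintype.ofFinite _

/-- The value patterns: two for counting, the first of which also carries the state of the
automaton, and one for every pair of a position modulo `m` and a token. -/
abbrev Pat (T : Type) (m : ℕ) : Type := Bool ⊕ (Fin m × T)

/-- The channels of the keys: two for counting, one for every position modulo `m`, two for every
state of the automaton, and an idle one. -/
abbrev KeyChan (m : ℕ) (σ : Type) : Type := Bool ⊕ Fin m ⊕ Option (Bool × σ)

section Sequences

variable {T : Type} {m : ℕ} [NeZero m]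

/-- The token `d` positions before position `t` of `w`, if there is one. -/
def histSeq (w : List T) (t : ℕ) (d : Fin m) : Option T :=
  if (d : ℕ) ≤ t then w[t - d]? else none

/-- The contents of the stream before the first layer. -/
def tokenInfo (m : ℕ) [NeZero m] (w : List T) (t : ℕ) : Info T m :=
  ⟨w[t]?, false, 0, fun _ => none, false⟩

/-- The contents of the stream once the parity of the position is known. -/
def parityInfo (m : ℕ) [NeZero m] (w : List T) (t : ℕ) : Info T m :=
  ⟨w[t]?, decide (t = 0), Fin.ofNat m (t % 2), fun _ => none, false⟩

/-- The contents of the stream once the position modulo `m` is known. -/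
def counterInfo (m : ℕ) [NeZero m] (w : List T) (t : ℕ) : Info T m :=
  ⟨w[t]?, decide (t = 0), Fin.ofNat m t, fun _ => none, false⟩

/-- The contents of the stream once the latest tokens are known. -/
def historyInfo (m : ℕ) [NeZero m] (w : List T) (t : ℕ) : Info T m :=
  ⟨w[t]?, decide (t = 0), Fin.ofNat m t, histSeq w t, false⟩

end Sequences

section UnitCoeff

variable {I R K : Type} [Fintype K]

theorem unitCoeff_neg [Fintype I] [Fintype R] (y : R → ℝ) :
    unitCoeff I K (-y) = -unitCoeff I K y := by
  simp [unitCoeff]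

theorem state_eq_zero {a : ℝ} {n : ℕ} {k : ℕ → K → ℝ} {c : ℕ → R → ℝ} {z : ℕ → R → K → ℝ}
    (hz : IsStateSeq a n k c z) {ρ : R} (hc : ∀ t < n, c t ρ = 0) {t : ℕ} (ht : t ≤ n) :
    z t ρ = 0 := by
  induction t with
  | zero => rw [hz.1]; rfl
  | succ t ih => rw [hz.2 t ht, ih (by omega), hc t ht]; simp

theorem exists_isStateSeq (a : ℝ) (k : ℕ → K → ℝ) (c : ℕ → R → ℝ) :
    ∃ z, ∀ n, IsStateSeq a n k c z :=
  ⟨fun t => Nat.rec 0 (fun t z ρ =>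
    rate • z ρ - (a * (z ρ ⬝ᵥ k t / (k t ⬝ᵥ k t))) • k t + c t ρ • k t) t,
    fun _ => ⟨rfl, fun _ _ _ => rfl⟩⟩

end UnitCoeff

section Layers

variable {T σ : Type} {m : ℕ} [DecidableEq T]

/-- The coefficient vector of one of the two counting patterns. -/
def countPat (T : Type) (m : ℕ) [DecidableEq T] (b : Bool) : Pat T m → ℝ := Pi.single (.inl b) 1

theorem countPat_ne_zero (b : Bool) : countPat T m b ≠ 0 := by
  intro h
  have := congrFun h (.inl b)
  simp [countPat] at this

variable [Fintype T] [Fintype σ] [DecidableEq σ] [NeZero m]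

/-- The value coefficients of the first layer, as a function of the contents of the later ones. -/
def firstCoeff (i : Info T m) : Pat T m → ℝ := if i.first then countPat T m false else 0

/-! ### First layer: the parity of the position -/

/-- With a constant key and a learning rate above the decay, the state changes its sign in every
step, so that the normalized readout is the parity of the position.  The value is nonzero at the
first position only, where it shows up in the bonus. -/
def parityUpdate : Update (Info T m) (Pat T m) (KeyChan m σ) where
  key := fun _ => Pi.single (.inl false) 1
  read := fun _ => Pi.single (.inl false) 1
  cur := fun _ => countPat T m false
  prev := fun _ => -countPat T m false
  -- Any number between `rate` and `1` would do.
  learn := (1 + rate) / 2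
  bonus := 1
  target := {i | i.hist = (fun _ => none) ∧ i.acc = false ∧ (i.pos : ℕ) < 2 ∧
    (i.first = true → (i.pos : ℕ) = 0)}
  old := fun i => ⟨i.tok, false, 0, fun _ => none, false⟩
  coeff := fun i => unitCoeff (Info T m) (KeyChan m σ) ((-1 : ℝ) ^ (i.pos : ℕ) • countPat T m false)
    + firstCoeff i
  learn_pos := by have := rate_pos; linarith
  learn_lt_one := by have := rate_lt_one; linarith
  inj := by
    rintro ⟨tok, first, ⟨p, hp⟩, hist, acc⟩ ⟨rfl, rfl, hp2, hf⟩
      ⟨tok', first', ⟨p', hp'⟩, hist', acc'⟩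
      ⟨rfl, rfl, hp2', hf'⟩ hold hc
    obtain ⟨s, hs, he⟩ := exists_unitCoeff_eq_smul (I := Info T m) (K := KeyChan m σ)
      (countPat_ne_zero (T := T) (m := m) false)
    simp only [Info.mk.injEq] at hold
    obtain ⟨rfl, -⟩ := hold
    simp only at hp2 hp2' hf hf' hc
    have hc0 := congrFun hc (.inl false)
    have h1 : unitCoeff (Info T m) (KeyChan m σ) (-countPat T m false)
        = -(s • countPat T m false) := by rw [unitCoeff_neg, he]
    have hs' : ∀ q < 2, unitCoeff (Info T m) (KeyChan m σ) ((-1 : ℝ) ^ q • countPat T m false)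
        (.inl false) = if q = 0 then s else -s := by
      intro q hq
      interval_cases q
      · rw [pow_zero, one_smul, he]
        simp [countPat]
      · rw [pow_one, neg_one_smul, h1]
        simp [countPat]
    have hF : ∀ f : Bool, (if f = true then countPat T m false else 0) (.inl false)
        = if f = true then (1 : ℝ) else 0 := by
      intro f
      cases f <;> simp [countPat]
    simp only [Pi.add_apply, hs' p hp2, hs' p' hp2', firstCoeff, hF] at hc0
    have : p = p' ∧ first = first' := by
      clear hs' hc hF he h1
      cases first <;> cases first' <;> simp only [reduceCtorEq, if_true, if_false,
        forall_const, IsEmpty.forall_iff] at hf hf' hc0 ⊢ <;> split_ifs at hc0 <;>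
        first | exact ⟨by omega, trivial⟩ | (exfalso; linarith)
    obtain ⟨rfl, rfl⟩ := this
    rfl

theorem valueCoeff_parityUpdate (i : ℕ → Info T m) (t : ℕ) :
    valueCoeff (parityUpdate (T := T) (σ := σ)).cur (parityUpdate (T := T) (σ := σ)).prev i t
      = if t = 0 then countPat T m false else 0 := by
  unfold valueCoeff parityUpdate
  by_cases h : t = 0 <;> simp [h]

theorem parityUpdate_runs (hm : 2 ≤ m) (w : List T) :
    (parityUpdate (T := T) (σ := σ)).Runs w.length (tokenInfo m w) (parityInfo m w) := by
  set r : ℝ := rate - (1 + rate) / 2 with hr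
  have hr0 : 0 < -r := by have := rate_lt_one; rw [hr]; linarith
  let z : ℕ → Pat T m → KeyChan m σ → ℝ := fun t ρ => match t with
    | 0 => 0
    | t + 1 => (r ^ t * countPat T m false ρ) • Pi.single (.inl false) 1
  refine ⟨z, ⟨rfl, fun t ht ρ => ?_⟩, fun t ht => ?_⟩
  · rw [valueCoeff_parityUpdate]
    simp only [parityUpdate]
    rcases t with _ | t
    · simp [z]
    · ext κ
      simp [z, hr]
      ring
  · have hread : readCoeff (parityUpdate (T := T) (σ := σ)).read (tokenInfo m w) z t
        = r ^ t • countPat T m false := by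
      funext ρ
      simp [readCoeff, parityUpdate, z]
    have hval : ((Fin.ofNat m (t % 2) : Fin m) : ℕ) = t % 2 := by
      simp only [Fin.val_ofNat]
      exact Nat.mod_eq_of_lt (by omega)
    have hpow : r ^ t • countPat T m false
        = (-r) ^ t • ((-1 : ℝ) ^ (t % 2) • countPat T m false) := by
      rw [smul_smul, ← neg_one_pow_eq_pow_mod_two, ← mul_pow]
      simp
    refine ⟨⟨rfl, rfl, ?_, ?_⟩, rfl, ?_, ?_, ?_⟩
    · simp only [parityInfo, hval]; omega
    · simp only [parityInfo, hval, decide_eq_true_eq]; omega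
    · intro h
      have := congrFun h (.inl false)
      simp [parityUpdate] at this
    · rw [hread]
      exact smul_ne_zero (pow_ne_zero _ (by linarith)) (countPat_ne_zero _)
    · rw [hread, hpow, unitCoeff_smul (pow_pos hr0 t), valueCoeff_parityUpdate]
      simp [parityUpdate, parityInfo, firstCoeff, Nat.mod_eq_of_lt (show t % 2 < m by omega)]

end Layers

/-! ### Second layer: the position modulo `m` -/

section Counter

/-- The angle by which a step of the second layer, followed by the exchange of the two keys, turns
the state, up to a change of basis. -/
def angle (m : ℕ) : ℝ := 2 * Real.pi / m

/-- The factor by which each step of the second layer scales the state, up to a change of basis. -/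
def radius : ℝ := Real.sqrt (rate * ((1 - rate) / 2))

theorem radius_pos : 0 < radius :=
  Real.sqrt_pos.2 (mul_pos rate_pos (by linarith [rate_lt_one]))

theorem radius_sq : radius ^ 2 = rate * ((1 - rate) / 2) :=
  Real.sq_sqrt (mul_pos rate_pos (by linarith [rate_lt_one])).le

theorem sin_angle_pos {m : ℕ} (hm : 3 ≤ m) : 0 < Real.sin (angle m) := by
  have h : (3 : ℝ) ≤ m := by exact_mod_cast hm
  apply Real.sin_pos_of_pos_of_lt_pi
  · unfold angle; positivity
  · rw [angle, div_lt_iff₀ (by linarith)]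
    nlinarith [Real.pi_pos]

/-- The inner product of the two unit vectors that serve as keys at even and at odd positions.  With
it, the trace of a step, followed by the exchange of the two keys, is that of a rotation by
`angle m` scaled by `radius`. -/
def keyInner (m : ℕ) : ℝ := -(2 * radius * Real.cos (angle m)) / ((1 + rate) / 2)

theorem learn_mul_keyInner (m : ℕ) :
    (1 + rate) / 2 * keyInner m = -(2 * radius * Real.cos (angle m)) := by
  have := rate_pos
  rw [keyInner, mul_div_cancel₀]
  positivity

theorem keyInner_sq_lt_one {m : ℕ} (hm : 3 ≤ m) : keyInner m ^ 2 < 1 := by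
  have h0 := rate_pos
  have h1 := sin_angle_pos hm
  have h2 := Real.sin_sq_add_cos_sq (angle m)
  have h3 : 0 < radius ^ 2 := pow_pos radius_pos 2
  rw [keyInner, div_pow, div_lt_one (by positivity)]
  calc (-(2 * radius * Real.cos (angle m))) ^ 2
      = 4 * radius ^ 2 - 4 * radius ^ 2 * Real.sin (angle m) ^ 2 := by
        rw [show Real.sin (angle m) ^ 2 = 1 - Real.cos (angle m) ^ 2 by linarith]; ring
    _ < 4 * radius ^ 2 := by
        have := mul_pos h3 (pow_pos h1 2)
        linarith
    _ ≤ ((1 + rate) / 2) ^ 2 := by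
        rw [radius_sq]
        nlinarith [sq_nonneg (3 * rate - 1)]

/-- The coefficients of the state of the second layer. -/
def spiral (m : ℕ) (t : ℕ) : ℝ :=
  radius ^ t / (radius * Real.sin (angle m)) * Real.sin (t * angle m)

theorem spiral_zero (m : ℕ) : spiral m 0 = 0 := by simp [spiral]

theorem spiral_one {m : ℕ} (hm : 3 ≤ m) : spiral m 1 = 1 := by
  have h1 := sin_angle_pos hm
  have h2 := radius_pos
  simp only [spiral, pow_one, Nat.cast_one, one_mul]
  field_simp

/-- Chebyshev recurrence. -/
theorem spiral_add_two (m t : ℕ) : spiral m (t + 2) =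
    -((1 + rate) / 2 * keyInner m) * spiral m (t + 1) - rate * ((1 - rate) / 2) * spiral m t := by
  have h : Real.sin ((t + 2 : ℕ) * angle m)
      = 2 * Real.cos (angle m) * Real.sin ((t + 1 : ℕ) * angle m) - Real.sin (t * angle m) := by
    have e1 : ((t + 2 : ℕ) : ℝ) * angle m = (t + 1 : ℕ) * angle m + angle m := by push_cast; ring
    have e2 : (t : ℝ) * angle m = (t + 1 : ℕ) * angle m - angle m := by push_cast; ring
    rw [e1, e2, Real.sin_add, Real.sin_sub]
    ring
  rw [learn_mul_keyInner, ← radius_sq]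
  simp only [spiral, h]
  ring

variable {T σ : Type} {m : ℕ} [DecidableEq T]

/-- The keys of the second layer at even and at odd positions. -/
def turnKey (m : ℕ) (σ : Type) (t : ℕ) : KeyChan m σ → ℝ :=
  if t % 2 = 0 then Sum.elim (fun b => if b then 0 else 1) 0
  else Sum.elim (fun b => if b then Real.sqrt (1 - keyInner m ^ 2) else keyInner m) 0

theorem turnKey_mod_two (t : ℕ) : turnKey m σ (t % 2) = turnKey m σ t := by
  simp [turnKey]

theorem turnKey_add_two (t : ℕ) : turnKey m σ (t + 2) = turnKey m σ t := by
  simp [turnKey]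

theorem turnKey_dotProduct_self [Fintype σ] (hm : 3 ≤ m) (t : ℕ) :
    turnKey m σ t ⬝ᵥ turnKey m σ t = 1 := by
  have h := keyInner_sq_lt_one hm
  have h2 := Real.mul_self_sqrt (show 0 ≤ 1 - keyInner m ^ 2 by linarith)
  unfold turnKey
  split_ifs
  · simp [dotProduct, Fintype.sum_sum_type]
  · simp only [dotProduct, Fintype.sum_sum_type, Fintype.sum_bool, Sum.elim_inl, Sum.elim_inr]
    simp [h2]
    ring

theorem turnKey_dotProduct_succ [Fintype σ] (t : ℕ) :
    turnKey m σ t ⬝ᵥ turnKey m σ (t + 1) = keyInner m := by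
  have h : (t + 1) % 2 = 0 ↔ ¬ t % 2 = 0 := by omega
  unfold turnKey
  simp only [h]
  by_cases h' : t % 2 = 0 <;> simp [h', dotProduct, Fintype.sum_sum_type]

theorem turnKey_succ_dotProduct [Fintype σ] (t : ℕ) :
    turnKey m σ (t + 1) ⬝ᵥ turnKey m σ t = keyInner m := by
  rw [dotProduct_comm, turnKey_dotProduct_succ]

/-- The coefficients of the readout at a position with residue `p`, up to a positive factor. -/
def turnCoeff (T : Type) [DecidableEq T] (m p : ℕ) : Pat T m → ℝ :=
  (radius * Real.sin ((p + 1 : ℕ) * angle m)) • countPat T m false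
    + Real.sin (p * angle m) • countPat T m true

theorem turnCoeff_false (p : ℕ) :
    turnCoeff T m p (.inl false) = radius * Real.sin ((p + 1 : ℕ) * angle m) := by
  simp [turnCoeff, countPat]

theorem turnCoeff_true (p : ℕ) : turnCoeff T m p (.inl true) = Real.sin (p * angle m) := by
  simp [turnCoeff, countPat]

theorem sin_succ_mul_angle (m p : ℕ) : Real.sin ((p + 1 : ℕ) * angle m)
    = Real.sin (p * angle m) * Real.cos (angle m)
      + Real.cos (p * angle m) * Real.sin (angle m) := by
  rw [← Real.sin_add]
  push_cast
  ring_nf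

theorem turnCoeff_ne_zero (hm : 3 ≤ m) (p : ℕ) : turnCoeff T m p ≠ 0 := by
  intro h
  have h1 : turnCoeff T m p (.inl false) = 0 := by rw [h]; rfl
  have h2 : turnCoeff T m p (.inl true) = 0 := by rw [h]; rfl
  rw [turnCoeff_true] at h2
  rw [turnCoeff_false, sin_succ_mul_angle, h2] at h1
  have h3 : Real.cos (p * angle m) = 0 := by
    have := (sin_angle_pos hm).ne'
    have := radius_pos.ne'
    simp_all
  have := Real.sin_sq_add_cos_sq (p * angle m)
  rw [h2, h3] at this
  norm_num at this

theorem turnCoeff_mod (hm : m ≠ 0) (t : ℕ) : turnCoeff T m (t % m) = turnCoeff T m t := by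
  have hm' : (m : ℝ) ≠ 0 := by exact_mod_cast hm
  have key : ∀ s : ℕ, Real.sin ((s + t : ℕ) * angle m) = Real.sin ((s + t % m : ℕ) * angle m) := by
    intro s
    have : ((s + t : ℕ) : ℝ) * angle m
        = (s + t % m : ℕ) * angle m + (t / m : ℕ) * (2 * Real.pi) := by
      have h : t = t % m + m * (t / m) := (Nat.mod_add_div t m).symm
      have h' : (t : ℝ) = (t % m : ℕ) + m * (t / m : ℕ) := by exact_mod_cast h
      push_cast
      rw [h', angle]
      field_simp
      ring
    rw [this, Real.sin_add_nat_mul_two_pi]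
  have k0 := key 0
  have k1 := key 1
  simp only [zero_add] at k0
  rw [turnCoeff, turnCoeff, add_comm (t % m) 1, add_comm t 1, k0, k1]

/-- The readout, up to a positive factor, determines the residue of the position. -/
theorem eq_of_smul_turnCoeff_eq (hm : 3 ≤ m) {p q : ℕ} (hp : p < m) (hq : q < m) {c d : ℝ}
    (hc : 0 < c) (hd : 0 < d) (h : c • turnCoeff T m p = d • turnCoeff T m q) : p = q := by
  have hs := sin_angle_pos hm
  have h1 : c * Real.sin (p * angle m) = d * Real.sin (q * angle m) := by
    have := congrFun h (.inl true)
    simpa only [Pi.smul_apply, smul_eq_mul, turnCoeff_true] using this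
  have h2 : c * Real.cos (p * angle m) = d * Real.cos (q * angle m) := by
    have := congrFun h (.inl false)
    simp only [Pi.smul_apply, smul_eq_mul, turnCoeff_false, sin_succ_mul_angle] at this
    have h3 : radius * Real.sin (angle m) * (c * Real.cos (p * angle m))
        = radius * Real.sin (angle m) * (d * Real.cos (q * angle m)) := by
      linear_combination this - radius * Real.cos (angle m) * h1
    exact mul_left_cancel₀ (mul_pos radius_pos hs).ne' h3
  have hcd : c = d := by
    have e1 := Real.sin_sq_add_cos_sq (p * angle m)
    have e2 := Real.sin_sq_add_cos_sq (q * angle m)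
    have : c ^ 2 = d ^ 2 := by
      calc c ^ 2 = (c * Real.sin (p * angle m)) ^ 2 + (c * Real.cos (p * angle m)) ^ 2 := by
            linear_combination (-c ^ 2) * e1
        _ = _ := by rw [h1, h2]; linear_combination d ^ 2 * e2
    exact (sq_eq_sq₀ hc.le hd.le).1 this
  subst hcd
  have a := Real.Angle.cos_sin_inj (mul_left_cancel₀ hc.ne' h2) (mul_left_cancel₀ hc.ne' h1)
  obtain ⟨k, hk⟩ := Real.Angle.angle_eq_iff_two_pi_dvd_sub.1 a
  have hm' : (m : ℝ) ≠ 0 := by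
    have : m ≠ 0 := by omega
    exact_mod_cast this
  have h4 : (p : ℤ) - q = m * k := by
    have h5 : 2 * Real.pi * ((p : ℝ) - q) = 2 * Real.pi * (m * k) := by
      rw [angle] at hk
      field_simp at hk
      linear_combination (2 * Real.pi) * hk
    have := mul_left_cancel₀ (by positivity) h5
    exact_mod_cast this
  have hk0 : k = 0 := by
    have hm0 : (0 : ℤ) < m := by omega
    have l1 : (m : ℤ) * k < m * 1 := by omega
    have l2 : (m : ℤ) * (-1) < m * k := by omega
    have := lt_of_mul_lt_mul_left l1 hm0.le
    have := lt_of_mul_lt_mul_left l2 hm0.le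
    omega
  subst hk0
  omega

variable [Fintype T] [Fintype σ] [NeZero m]

/-- The keys of even and of odd positions alternate.  As the learning rate exceeds the decay, each
step reverses the direction of the key, and a step followed by the exchange of the two keys acts, up
to a change of basis and a positive factor, as a rotation by `angle m`.  A second copy of the state
starts one step later, and the two readouts together, up to a common positive factor, determine the
position modulo `m`.  The receptance is orthogonal to the key of the next position. -/
def counterUpdate (hm : 3 ≤ m) : Update (Info T m) (Pat T m) (KeyChan m σ) where
  key := fun i => turnKey m σ i.pos
  read := fun i => turnKey m σ i.pos - keyInner m • turnKey m σ (i.pos + 1)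
  cur := firstCoeff
  prev := fun i => if i.first then countPat T m true else 0
  learn := (1 + rate) / 2
  bonus := 0
  target := {i | i.hist = (fun _ => none) ∧ i.acc = false}
  old := fun i => ⟨i.tok, i.first, Fin.ofNat m (i.pos % 2), fun _ => none, false⟩
  coeff := fun i => unitCoeff (Info T m) (KeyChan m σ) (turnCoeff T m i.pos)
  learn_pos := by have := rate_pos; linarith
  learn_lt_one := by have := rate_lt_one; linarith
  inj := by
    rintro ⟨tok, first, ⟨p, hp⟩, hist, acc⟩ ⟨rfl, rfl⟩ ⟨tok', first', ⟨q, hq⟩, hist', acc'⟩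
      ⟨rfl, rfl⟩ hold hc
    obtain ⟨c, hc0, hce⟩ := exists_unitCoeff_eq_smul (I := Info T m) (K := KeyChan m σ)
      (turnCoeff_ne_zero (T := T) hm p)
    obtain ⟨d, hd0, hde⟩ := exists_unitCoeff_eq_smul (I := Info T m) (K := KeyChan m σ)
      (turnCoeff_ne_zero (T := T) hm q)
    simp only [Info.mk.injEq] at hold
    obtain ⟨rfl, rfl, -⟩ := hold
    simp only at hc
    rw [hce, hde] at hc
    obtain rfl := eq_of_smul_turnCoeff_eq hm hp hq hc0 hd0 hc
    rfl

theorem valueCoeff_counterUpdate (hm : 3 ≤ m) (w : List T) (t : ℕ) :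
    valueCoeff (counterUpdate (T := T) (σ := σ) hm).cur
      (counterUpdate (T := T) (σ := σ) hm).prev (parityInfo m w) t
      = (if t = 0 then countPat T m false else 0) + if t = 1 then countPat T m true else 0 := by
  unfold valueCoeff counterUpdate
  rcases t with _ | _ | t <;> simp [parityInfo, firstCoeff]

theorem counterUpdate_runs (hm : 3 ≤ m) (hm2 : 2 ∣ m) (w : List T) :
    (counterUpdate (T := T) (σ := σ) hm).Runs w.length (parityInfo m w) (counterInfo m w) := by
  have hval : ∀ t, (((parityInfo m w t).pos : Fin m) : ℕ) = t % 2 := fun t => by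
    simp only [parityInfo, Fin.val_ofNat]
    exact Nat.mod_eq_of_lt (by omega)
  have hsucc : ∀ t, turnKey m σ (t % 2 + 1) = turnKey m σ (t + 1) := fun t => by
    rw [← turnKey_mod_two (t % 2 + 1), ← turnKey_mod_two (t + 1)]
    congr 1
    omega
  have hkey : ∀ t, (counterUpdate (T := T) (σ := σ) hm).key (parityInfo m w t) = turnKey m σ t :=
    fun t => by
      simp only [counterUpdate, hval, turnKey_mod_two]
  have hread : ∀ t, (counterUpdate (T := T) (σ := σ) hm).read (parityInfo m w t)
      = turnKey m σ t - keyInner m • turnKey m σ (t + 1) := fun t => by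
    simp only [counterUpdate, hval, turnKey_mod_two, hsucc]
  -- The second copy of the state lags behind the first by one step.
  let z : ℕ → Pat T m → KeyChan m σ → ℝ := fun t ρ => match t with
    | 0 => 0
    | t + 1 => countPat T m false ρ •
        (spiral m (t + 1) • turnKey m σ t + (rate * spiral m t) • turnKey m σ (t + 1)) +
      countPat T m true ρ •
        (spiral m t • turnKey m σ t + (rate * spiral m (t - 1)) • turnKey m σ (t + 1))
  have hrec : ∀ t, rate ^ 2 * spiral m t - (1 + rate) / 2 * (spiral m (t + 1) * keyInner m
      + rate * spiral m t) = spiral m (t + 2) := fun t => by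
    rw [spiral_add_two]; ring
  have hz : IsStateSeq (counterUpdate (T := T) (σ := σ) hm).learn w.length
      (fun s => (counterUpdate (T := T) (σ := σ) hm).key (parityInfo m w s))
      (valueCoeff (counterUpdate (T := T) (σ := σ) hm).cur
        (counterUpdate (T := T) (σ := σ) hm).prev (parityInfo m w)) z := by
    refine ⟨rfl, fun t ht ρ => ?_⟩
    have hl : (counterUpdate (T := T) (σ := σ) hm).learn = (1 + rate) / 2 := rfl
    beta_reduce
    rw [valueCoeff_counterUpdate, hkey, turnKey_dotProduct_self hm, div_one, hl]
    rcases t with _ | t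
    · simp [z, spiral_zero, spiral_one hm]
    · have hdot : z (t + 1) ρ ⬝ᵥ turnKey m σ (t + 1)
          = countPat T m false ρ * (spiral m (t + 1) * keyInner m + rate * spiral m t) +
            countPat T m true ρ * (spiral m t * keyInner m + rate * spiral m (t - 1)) := by
        simp only [z, add_dotProduct, smul_dotProduct, turnKey_dotProduct_succ,
          turnKey_dotProduct_self hm, smul_eq_mul, mul_one]
      rw [hdot]
      funext κ
      simp only [z, Pi.add_apply, Pi.sub_apply, Pi.smul_apply, smul_eq_mul, turnKey_add_two,
        Nat.add_sub_cancel]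
      rcases t with _ | t
      · have := hrec 0
        simp only [zero_add] at this
        simp [spiral_zero, spiral_one hm] at this ⊢
        rw [← this]
        ring
      · have h1 := hrec t
        have h2 := hrec (t + 1)
        simp only [Nat.add_sub_cancel]
        rw [if_neg (by omega), if_neg (by omega)]
        simp only [add_zero, Pi.zero_apply, zero_mul]
        linear_combination (-countPat T m false ρ * turnKey m σ (t + 1 + 1) κ) * h2
          - (countPat T m true ρ * turnKey m σ (t + 1 + 1) κ) * h1
  have hreadCoeff : ∀ t, readCoeff (counterUpdate (T := T) (σ := σ) hm).read (parityInfo m w) z t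
      = ((1 - keyInner m ^ 2) * (radius ^ t / (radius * Real.sin (angle m))))
        • turnCoeff T m t := by
    intro t
    funext ρ
    rw [readCoeff, hread]
    have e1 : (turnKey m σ t - keyInner m • turnKey m σ (t + 1)) ⬝ᵥ turnKey m σ t
        = 1 - keyInner m ^ 2 := by
      rw [sub_dotProduct, smul_dotProduct, turnKey_dotProduct_self hm, turnKey_succ_dotProduct,
        smul_eq_mul, sq]
    have e2 : (turnKey m σ t - keyInner m • turnKey m σ (t + 1)) ⬝ᵥ turnKey m σ (t + 1) = 0 := by
      rw [sub_dotProduct, smul_dotProduct, turnKey_dotProduct_self hm, turnKey_dotProduct_succ,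
        smul_eq_mul, mul_one, sub_self]
    simp only [z, dotProduct_add, dotProduct_smul, e1, e2, smul_eq_mul, turnCoeff, Pi.add_apply,
      Pi.smul_apply, spiral, pow_succ]
    ring
  have hpos : ∀ t : ℕ, 0 < (1 - keyInner m ^ 2) * (radius ^ t / (radius * Real.sin (angle m))) := by
    intro t
    have h1 := keyInner_sq_lt_one hm
    have h2 := radius_pos
    have h3 := sin_angle_pos hm
    exact mul_pos (by linarith) (by positivity)
  refine ⟨z, hz, fun t ht => ⟨⟨rfl, rfl⟩, ?_, ?_, ?_, ?_⟩⟩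
  · simp [counterUpdate, counterInfo, parityInfo, Nat.mod_mod_of_dvd t hm2]
  · rw [hkey]
    intro h
    have := turnKey_dotProduct_self (σ := σ) hm t
    rw [h] at this
    simp at this
  · rw [hreadCoeff]
    exact smul_ne_zero (hpos t).ne' (turnCoeff_ne_zero hm t)
  · rw [hreadCoeff, unitCoeff_smul (hpos t)]
    simp [counterUpdate, counterInfo, turnCoeff_mod (NeZero.ne m)]

end Counter

/-! ### Third layer: the latest tokens -/

section History

variable {T σ : Type} {m : ℕ} [NeZero m]

theorem historyInfo_hist (w : List T) (t : ℕ) : (historyInfo m w t).hist = histSeq w t := rfl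

variable [DecidableEq T]

/-- The coefficients of the readout of the third layer: a token `d` positions back contributes
with weight `rate ^ d` to the pattern of its position modulo `m`. -/
def windowCoeff (i : Info T m) : Pat T m → ℝ
  | .inl _ => 0
  | .inr (j, v) => if i.hist (i.pos - j) = some v then rate ^ ((i.pos - j : Fin m) : ℕ) else 0

/-- The state of the third layer after position `t`. -/
def historyState (m : ℕ) [NeZero m] (σ : Type) (w : List T) (t : ℕ) : Pat T m → KeyChan m σ → ℝ
  | .inr (j, v), .inr (.inl j') =>
    if j = j' then windowCoeff (historyInfo m w t) (.inr (j, v)) else 0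
  | _, _ => 0

theorem ofNat_succ (t : ℕ) : (Fin.ofNat m (t + 1) : Fin m) = Fin.ofNat m t + 1 := by
  ext
  simp [Fin.val_add, Nat.add_mod]

theorem windowCoeff_zero (w : List T) (j : Fin m) (v : T) :
    windowCoeff (historyInfo m w 0) (.inr (j, v)) = if j = 0 ∧ w[0]? = some v then 1 else 0 := by
  have : (historyInfo m w 0).pos = 0 := by ext; simp [historyInfo]
  simp only [windowCoeff, this, historyInfo_hist, histSeq, zero_sub]
  by_cases h : j = 0
  · subst h
    simp
  · have h' : ((-j : Fin m) : ℕ) ≠ 0 := fun e => h (by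
      have : (-j : Fin m) = 0 := Fin.ext (by simpa using e)
      simpa using this)
    simp [h, h']

theorem windowCoeff_succ (w : List T) (t : ℕ) (j : Fin m) (v : T) :
    windowCoeff (historyInfo m w (t + 1)) (.inr (j, v)) =
      if j = Fin.ofNat m (t + 1) then (if w[t + 1]? = some v then 1 else 0)
      else rate * windowCoeff (historyInfo m w t) (.inr (j, v)) := by
  have h1 : (historyInfo m w (t + 1)).pos = Fin.ofNat m (t + 1) := rfl
  have h2 : (historyInfo m w t).pos = Fin.ofNat m t := rfl
  simp only [windowCoeff, historyInfo_hist, histSeq, h1, h2]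
  by_cases h : j = Fin.ofNat m (t + 1)
  · rw [if_pos h, h, sub_self]
    simp
  · rw [if_neg h]
    have hd : Fin.ofNat m (t + 1) - j = (Fin.ofNat m t - j) + 1 := by
      rw [ofNat_succ]; abel
    have hne : (Fin.ofNat m t - j : Fin m) + 1 ≠ 0 := fun e => h (by
      rw [← hd, sub_eq_zero] at e; exact e.symm)
    have hv : (((Fin.ofNat m t - j : Fin m) + 1 : Fin m) : ℕ)
        = ((Fin.ofNat m t - j : Fin m) : ℕ) + 1 := by
      generalize (Fin.ofNat m t - j : Fin m) = e at hne
      apply Fin.val_add_one_of_lt'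
      by_contra hlt
      have hem : (e : ℕ) + 1 = m := by have := e.isLt; omega
      apply hne
      ext
      simp [Fin.val_add, hem]
    rw [hd, hv]
    simp only [Nat.add_le_add_iff_right, Nat.add_sub_add_right, pow_succ]
    split_ifs <;> simp [mul_comm]

variable [Fintype T] [Fintype σ] [DecidableEq σ]

/-- The key at a position `t` is the unit vector of `t` modulo `m`.  As the learning rate equals
the decay, it erases what was stored there `m` steps ago, and stores the present token. -/
def historyUpdate : Update (Info T m) (Pat T m) (KeyChan m σ) where
  key := fun i => Pi.single (.inr (.inl i.pos)) 1
  read := fun _ => Sum.elim 0 (Sum.elim 1 0)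
  cur := fun i => Sum.elim 0 fun jv => if jv.1 = i.pos ∧ i.tok = some jv.2 then 1 else 0
  prev := 0
  learn := rate
  bonus := 0
  target := {i | i.acc = false ∧ windowCoeff i ≠ 0}
  old := fun i => ⟨i.tok, i.first, i.pos, fun _ => none, false⟩
  coeff := fun i => unitCoeff (Info T m) (KeyChan m σ) (windowCoeff i)
  learn_pos := rate_pos
  learn_lt_one := rate_lt_one
  inj := by
    rintro ⟨tok, first, p, hist, acc⟩ ⟨rfl, h0⟩ ⟨tok', first', q, hist', acc'⟩ ⟨rfl, h0'⟩ hold hc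
    obtain ⟨c, hc0, hce⟩ := exists_unitCoeff_eq_smul (I := Info T m) (K := KeyChan m σ) h0
    obtain ⟨d, hd0, hde⟩ := exists_unitCoeff_eq_smul (I := Info T m) (K := KeyChan m σ) h0'
    simp only [Info.mk.injEq] at hold
    obtain ⟨rfl, rfl, rfl, -⟩ := hold
    rw [hce, hde] at hc
    have : hist = hist' := by
      funext e
      apply Option.ext
      intro v
      have h1 := congrFun hc (.inr (p - e, v))
      simp only [Pi.smul_apply, windowCoeff, smul_eq_mul, sub_sub_cancel] at h1
      have h2 : 0 < rate ^ (e : ℕ) := pow_pos rate_pos _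
      have h3 := mul_pos hc0 h2
      have h4 := mul_pos hd0 h2
      constructor
      · intro h
        by_contra h'
        rw [if_pos h, if_neg h', mul_zero] at h1
        exact h3.ne' h1
      · intro h
        by_contra h'
        rw [if_pos h, if_neg h', mul_zero] at h1
        exact h4.ne h1
    rw [this]

theorem historyUpdate_runs (w : List T) :
    (historyUpdate (T := T) (σ := σ)).Runs w.length (counterInfo m w) (historyInfo m w) := by
  have hpos : ∀ t, (historyInfo m w t).pos = Fin.ofNat m t := fun _ => rfl
  have hc : ∀ t, valueCoeff (historyUpdate (T := T) (σ := σ)).cur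
      (historyUpdate (T := T) (σ := σ)).prev (counterInfo m w) t
      = Sum.elim (0 : Bool → ℝ) fun jv =>
        if jv.1 = Fin.ofNat m t ∧ w[t]? = some jv.2 then 1 else 0 := by
    intro t
    simp [valueCoeff, historyUpdate, counterInfo]
  let z : ℕ → Pat T m → KeyChan m σ → ℝ := fun t => match t with
    | 0 => 0
    | t + 1 => historyState m σ w t
  have hk : ∀ t, (historyUpdate (T := T) (σ := σ)).key (counterInfo m w t)
      = Pi.single (.inr (.inl (Fin.ofNat m t))) 1 := fun _ => rfl
  have hread : ∀ t, readCoeff (historyUpdate (T := T) (σ := σ)).read (counterInfo m w) z t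
      = windowCoeff (historyInfo m w t) := by
    intro t
    funext ρ
    rcases ρ with ρ | ⟨j, v⟩
    · simp [readCoeff, z, historyState, dotProduct, windowCoeff]
    · simp [readCoeff, z, historyState, dotProduct, historyUpdate, Fintype.sum_sum_type]
  have hne : ∀ t < w.length, windowCoeff (historyInfo m w t) ≠ 0 := by
    intro t ht h
    have := congrFun h (.inr (Fin.ofNat m t, w[t]))
    simp [windowCoeff, hpos, historyInfo_hist, histSeq, ht] at this
  refine ⟨z, ⟨rfl, fun t ht ρ => ?_⟩, fun t ht => ⟨⟨rfl, hne t ht⟩, rfl, ?_, ?_, ?_⟩⟩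
  · have hl : (historyUpdate (T := T) (σ := σ) (m := m)).learn = rate := rfl
    have hp : (Fin.ofNat m 0 : Fin m) = 0 := by ext; simp
    beta_reduce
    rw [hc, hk, hl]
    funext κ
    simp only [Pi.add_apply, Pi.sub_apply, Pi.smul_apply, smul_eq_mul, dotProduct_single_one,
      Pi.single_eq_same, div_one]
    rcases ρ with ρ | ⟨j, v⟩
    · rcases t with _ | t <;> simp [z, historyState]
    · rcases κ with κ | j' | κ
      · rcases t with _ | t <;> simp [z, historyState]
      · have hs : (Pi.single (.inr (.inl (Fin.ofNat m t))) 1 : KeyChan m σ → ℝ) (.inr (.inl j'))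
            = if j' = Fin.ofNat m t then 1 else 0 := by
          simp [Pi.single_apply]
        rw [hs]
        simp only [Sum.elim_inr]
        rcases t with _ | t
        · simp only [z, historyState, windowCoeff_zero, hp, Pi.zero_apply, mul_zero, zero_mul,
            sub_zero, zero_add]
          by_cases h1 : j = j' <;> by_cases h2 : j' = 0 <;> simp_all
        · simp only [z, historyState, windowCoeff_succ]
          by_cases h1 : j = j' <;> by_cases h2 : j' = Fin.ofNat m (t + 1) <;>
            by_cases h3 : w[t + 1]? = some v <;> simp_all
      · rcases t with _ | t <;> simp [z, historyState]
  · intro h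
    have := congrFun h (.inr (.inl (Fin.ofNat m t)))
    simp [hk] at this
  · rw [hread]
    exact hne t ht
  · rw [hread]
    simp [historyUpdate]

end History

/-! ### Maps between finite sets as products of projections -/

section Projections

variable {K : Type} [Fintype K]

/-- The projection along `u` onto the orthogonal complement of `u`. -/
def projAlong (z u : K → ℝ) : K → ℝ := z - (z ⬝ᵥ u / (u ⬝ᵥ u)) • u

theorem projAlong_dotProduct (z u y : K → ℝ) :
    projAlong z u ⬝ᵥ y = z ⬝ᵥ projAlong y u := by
  simp only [projAlong, sub_dotProduct, dotProduct_sub, smul_dotProduct, dotProduct_smul,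
    smul_eq_mul]
  rw [dotProduct_comm y u]
  ring

theorem projAlong_smul (c : ℝ) (z u : K → ℝ) : projAlong (c • z) u = c • projAlong z u := by
  simp only [projAlong, smul_dotProduct, smul_sub, smul_smul, smul_eq_mul, mul_div_assoc]

theorem foldl_projAlong_smul (c : ℝ) (z : K → ℝ) (l : List (K → ℝ)) :
    l.foldl projAlong (c • z) = c • l.foldl projAlong z := by
  induction l generalizing z with
  | nil => rfl
  | cons u l ih => rw [List.foldl_cons, projAlong_smul, ih, List.foldl_cons]

/-- Projections are self-adjoint, so that the linear form that results from applying some of them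
and then `y` can be read off by a receptance. -/
theorem foldl_projAlong_dotProduct (z y : K → ℝ) (l : List (K → ℝ)) :
    l.foldl projAlong z ⬝ᵥ y = z ⬝ᵥ l.foldr (fun u y => projAlong y u) y := by
  induction l generalizing z with
  | nil => rfl
  | cons u l ih => rw [List.foldl_cons, ih, projAlong_dotProduct, List.foldr_cons]

variable [DecidableEq K]

/-- Two directions.  The projection along the first sends the unit vectors of `x` and `y` to the
same vector, and the projection along the second then removes its component at `x`. -/
def mergeKeys (p : K × K) : List (K → ℝ) :=
  [Pi.single p.1 1 - Pi.single p.2 1, Pi.single p.1 1]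

theorem foldl_mergeKeys {x y : K} (hxy : x ≠ y) (a : K) :
    ∃ c : ℝ, 0 < c ∧ (mergeKeys (x, y)).foldl projAlong (Pi.single a 1)
      = c • Pi.single (if a = x then y else a) 1 := by
  have h2 : (Pi.single x 1 - Pi.single y 1 : K → ℝ) ⬝ᵥ (Pi.single x 1 - Pi.single y 1) = 2 := by
    simp [hxy, hxy.symm]
    norm_num
  have hs : ∀ b : K, projAlong (Pi.single b 1 : K → ℝ) (Pi.single x 1 - Pi.single y 1)
      = if b = x ∨ b = y then (1 / 2 : ℝ) • (Pi.single x 1 + Pi.single y 1) else Pi.single b 1 := by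
    intro b
    rw [projAlong, h2]
    funext κ
    by_cases h1 : b = x
    · subst h1
      simp [hxy]
      ring
    · by_cases h3 : b = y
      · subst h3
        simp [hxy, hxy.symm]
        ring
      · have h1' : x ≠ b := fun e => h1 e.symm
        have h3' : y ≠ b := fun e => h3 e.symm
        simp [h1, h3, h1', h3']
  simp only [mergeKeys, List.foldl_cons, List.foldl_nil, hs]
  have hx : projAlong ((1 / 2 : ℝ) • (Pi.single x 1 + Pi.single y 1) : K → ℝ) (Pi.single x 1)
      = (1 / 2 : ℝ) • Pi.single y 1 := by
    rw [projAlong_smul, projAlong]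
    simp [hxy]
  by_cases h1 : a = x
  · refine ⟨1 / 2, by norm_num, ?_⟩
    rw [if_pos (Or.inl h1), if_pos h1, hx]
  · by_cases h3 : a = y
    · refine ⟨1 / 2, by norm_num, ?_⟩
      rw [if_pos (Or.inr h3), if_neg h1, hx, h3]
    · refine ⟨1, one_pos, ?_⟩
      rw [if_neg (by tauto), if_neg h1, projAlong]
      have h1' : x ≠ a := fun e => h1 e.symm
      simp [h1']

theorem foldl_flatMap_mergeKeys (l : List (K × K)) (hl : ∀ p ∈ l, p.1 ≠ p.2) (a : K) :
    ∃ c : ℝ, 0 < c ∧ (l.flatMap mergeKeys).foldl projAlong (Pi.single a 1)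
      = c • Pi.single (l.foldl (fun a p => if a = p.1 then p.2 else a) a) 1 := by
  induction l generalizing a with
  | nil => exact ⟨1, one_pos, by simp⟩
  | cons p l ih =>
    obtain ⟨c, hc, he⟩ := foldl_mergeKeys (hl p (by simp)) a
    obtain ⟨d, hd, hf⟩ := ih (fun q hq => hl q (by simp [hq])) (if a = p.1 then p.2 else a)
    refine ⟨c * d, mul_pos hc hd, ?_⟩
    rw [List.flatMap_cons, List.foldl_append, he, foldl_projAlong_smul, hf, smul_smul,
      List.foldl_cons]

end Projections

theorem mergeKeys_ne_zero {K : Type} [DecidableEq K] {x y : K} (hxy : x ≠ y) :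
    ∀ u ∈ mergeKeys (x, y), u ≠ 0 := by
  intro u hu h
  have := congrFun h x
  simp only [mergeKeys, List.mem_cons, List.not_mem_nil, or_false] at hu
  rcases hu with rfl | rfl
  · simp [hxy] at this
  · simp at this

section Automaton

variable {σ : Type} {m : ℕ}

/-- The key channel of a state of the automaton in one of the two copies of its state space. -/
def stateKey (m : ℕ) (b : Bool) (s : σ) : KeyChan m σ := .inr (.inr (some (b, s)))

theorem foldl_map_stateKey [DecidableEq σ] (b : Bool) (g : σ → σ) (l : List σ) (s : σ) :
    (l.map fun s => (stateKey m b s, stateKey m (!b) (g s))).foldl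
      (fun a p => if a = p.1 then p.2 else a) (stateKey m b s)
      = if s ∈ l then stateKey m (!b) (g s) else stateKey m b s := by
  have hfix : ∀ (l : List σ) (s' : σ),
      (l.map fun s => (stateKey m b s, stateKey m (!b) (g s))).foldl
      (fun a p => if a = p.1 then p.2 else a) (stateKey m (!b) s') = stateKey m (!b) s' := by
    intro l s'
    induction l with
    | nil => rfl
    | cons x l ih =>
      rw [List.map_cons, List.foldl_cons, if_neg (by simp [stateKey]), ih]
  induction l with
  | nil => rfl
  | cons x l ih =>
    rw [List.map_cons, List.foldl_cons]
    by_cases h : s = x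
    · subst h
      rw [if_pos rfl, hfix, if_pos (by simp)]
    · rw [if_neg (by simpa [stateKey] using h), ih]
      simp [h]

variable [Fintype σ]

/-- The merges that compute `f`: from the first copy of the state space into the second, following
`f`, and back.  The second copy keeps images apart from states that are still to be mapped. -/
def mapPairs (m : ℕ) (f : σ → σ) : List (KeyChan m σ × KeyChan m σ) :=
  (Finset.univ : Finset σ).toList.map (fun s => (stateKey m false s, stateKey m true (f s))) ++
    (Finset.univ : Finset σ).toList.map fun s => (stateKey m true s, stateKey m false s)

theorem mapPairs_ne (f : σ → σ) : ∀ p ∈ mapPairs m f, p.1 ≠ p.2 := by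
  intro p hp
  simp only [mapPairs, List.mem_append, List.mem_map] at hp
  rcases hp with ⟨s, -, rfl⟩ | ⟨s, -, rfl⟩ <;> simp [stateKey]

variable [DecidableEq σ]

theorem foldl_mapPairs (f : σ → σ) (s : σ) :
    (mapPairs m f).foldl (fun a p => if a = p.1 then p.2 else a) (stateKey m false s)
      = stateKey m false (f s) := by
  rw [mapPairs, List.foldl_append]
  have h1 := foldl_map_stateKey (m := m) false f Finset.univ.toList s
  have h2 := foldl_map_stateKey (m := m) true id Finset.univ.toList (f s)
  simp only [Finset.mem_toList, Finset.mem_univ, if_true, Bool.not_false, Bool.not_true, id]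
    at h1 h2
  rw [h1, h2]

/-- The keys by which a block of positions computes `f`; the first of them does nothing. -/
def mapKeys (m : ℕ) (f : σ → σ) : List (KeyChan m σ → ℝ) :=
  Pi.single (.inr (.inr none)) 1 :: (mapPairs m f).flatMap mergeKeys

/-- The number of positions in a block. -/
def blockLength (σ : Type) [Fintype σ] : ℕ := 4 * Fintype.card σ + 1

theorem length_mapKeys (f : σ → σ) : (mapKeys m f).length = blockLength σ := by
  have h : ∀ l : List (KeyChan m σ × KeyChan m σ), (l.flatMap mergeKeys).length = 2 * l.length := by
    intro l
    induction l with
    | nil => rfl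
    | cons p l ih => simp [ih, mergeKeys]; ring
  rw [mapKeys, List.length_cons, h, blockLength, mapPairs]
  simp
  ring

theorem mapKeys_ne_zero (f : σ → σ) : ∀ u ∈ mapKeys m f, u ≠ 0 := by
  intro u hu
  simp only [mapKeys, List.mem_cons, List.mem_flatMap] at hu
  rcases hu with rfl | ⟨⟨x, y⟩, hp, hu⟩
  · intro h
    have := congrFun h (.inr (.inr none))
    simp at this
  · exact mergeKeys_ne_zero (mapPairs_ne f _ hp) u hu

theorem projAlong_idle (s : σ) :
    projAlong (Pi.single (stateKey m false s) 1) (Pi.single (.inr (.inr none)) 1)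
      = Pi.single (stateKey m false s) (1 : ℝ) := by
  rw [projAlong]
  simp [stateKey]

theorem foldl_mapKeys (f : σ → σ) (s : σ) :
    ∃ c : ℝ, 0 < c ∧ (mapKeys m f).foldl projAlong (Pi.single (stateKey m false s) 1)
      = c • Pi.single (stateKey m false (f s)) 1 := by
  obtain ⟨c, hc, h⟩ := foldl_flatMap_mergeKeys (mapPairs m f) (mapPairs_ne f) (stateKey m false s)
  refine ⟨c, hc, ?_⟩
  rw [mapKeys, List.foldl_cons, projAlong_idle, h, foldl_mapPairs]

end Automaton

/-! ### Fourth layer: the automaton -/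

theorem filterMap_range_getElem? {T : Type*} (w : List T) (a n : ℕ) :
    (List.range n).filterMap (fun d => w[a + d]?) = (w.drop a).take n := by
  induction n with
  | zero => simp
  | succ n ih =>
    rw [List.range_succ, List.filterMap_append, ih, List.take_add_one, List.getElem?_drop]
    congr 1

section AutomatonLayer

variable {T σ : Type} {m : ℕ} [Fintype σ]

/-- The index of a position within its block. -/
def blockIndex (σ : Type) [Fintype σ] (i : Info T m) : ℕ := (i.pos : ℕ) % blockLength σ

theorem blockIndex_lt (i : Info T m) : blockIndex σ i < blockLength σ :=
  Nat.mod_lt _ (Nat.succ_pos _)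

variable [NeZero m]

/-- The part of the current block that has been read. -/
def currentWord (σ : Type) [Fintype σ] (i : Info T m) : List T :=
  (List.range (blockIndex σ i + 1)).filterMap fun d => i.hist (Fin.ofNat m (blockIndex σ i - d))

/-- The previous block; it is empty while the first block is read. -/
def previousWord (σ : Type) [Fintype σ] (i : Info T m) : List T :=
  (List.range (blockLength σ)).filterMap fun d =>
    i.hist (Fin.ofNat m (blockIndex σ i + blockLength σ - d))

theorem blockIndex_historyInfo (hm : blockLength σ ∣ m) (w : List T) (t : ℕ) :
    blockIndex σ (historyInfo m w t) = t % blockLength σ := by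
  simp only [blockIndex, historyInfo, Fin.val_ofNat]
  exact Nat.mod_mod_of_dvd t hm

theorem currentWord_historyInfo (hm : blockLength σ ∣ m) (w : List T) (t : ℕ) :
    currentWord σ (historyInfo m w t)
      = (w.drop (blockLength σ * (t / blockLength σ))).take (t % blockLength σ + 1) := by
  have hB : blockLength σ ≤ m := Nat.le_of_dvd (NeZero.pos m) hm
  have hj : t % blockLength σ < blockLength σ := Nat.mod_lt _ (Nat.succ_pos _)
  have ht := Nat.div_add_mod t (blockLength σ)
  rw [currentWord, blockIndex_historyInfo hm, ← filterMap_range_getElem?]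
  refine List.filterMap_congr fun d hd => ?_
  rw [List.mem_range] at hd
  rw [historyInfo_hist, histSeq, Fin.val_ofNat, Nat.mod_eq_of_lt (by omega), if_pos (by omega)]
  congr 1
  omega

theorem previousWord_historyInfo (hm : m = 2 * blockLength σ) (w : List T) (t : ℕ) :
    previousWord σ (historyInfo m w t)
      = (w.take (blockLength σ * (t / blockLength σ))).drop
          (blockLength σ * (t / blockLength σ - 1)) := by
  have hj : t % blockLength σ < blockLength σ := Nat.mod_lt _ (Nat.succ_pos _)
  have ht := Nat.div_add_mod t (blockLength σ)
  have hval : ∀ d ∈ List.range (blockLength σ),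
      ((Fin.ofNat m (t % blockLength σ + blockLength σ - d) : Fin m) : ℕ)
        = t % blockLength σ + blockLength σ - d := by
    intro d _
    rw [Fin.val_ofNat, Nat.mod_eq_of_lt (by omega)]
  rw [previousWord, blockIndex_historyInfo ⟨2, by omega⟩]
  rcases hq : t / blockLength σ with _ | q
  · rw [hq] at ht
    simp only [mul_zero, List.take_zero, List.drop_nil, List.filterMap_eq_nil_iff]
    intro d hd
    have := List.mem_range.1 hd
    rw [historyInfo_hist, histSeq, hval d hd, if_neg (by omega)]
  · rw [hq, Nat.mul_succ] at ht
    rw [Nat.add_sub_cancel, List.drop_take, Nat.mul_succ, Nat.add_sub_cancel_left,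
      ← filterMap_range_getElem?]
    refine List.filterMap_congr fun d hd => ?_
    have := List.mem_range.1 hd
    rw [historyInfo_hist, histSeq, hval d hd, if_pos (by omega)]
    congr 1
    omega

variable (A : DFA T σ)

/-- The state transformation of the previous block. -/
def blockMap (i : Info T m) (s : σ) : σ := A.evalFrom s (previousWord σ i)

open Classical in
/-- Marks, with signs, the states from which the current block, as far as it has been read, leads
to acceptance. -/
def acceptSign (i : Info T m) : KeyChan m σ → ℝ
  | .inr (.inr (some (_, s))) => if A.evalFrom s (currentWord σ i) ∈ A.accept then 1 else -1
  | _ => 0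

open Classical in
/-- The contents of the stream once it is known whether the prefix read is accepted. -/
def acceptInfo (m : ℕ) [NeZero m] (w : List T) (t : ℕ) : Info T m :=
  ⟨w[t]?, decide (t = 0), Fin.ofNat m t, histSeq w t,
    decide (A.eval (w.take (t + 1)) ∈ A.accept)⟩

/-- The state from which the keys of block `q` start. -/
def blockState (w : List T) (q : ℕ) : σ := A.eval (w.take (blockLength σ * (q - 1)))

theorem blockMap_blockState (hm : m = 2 * blockLength σ) (w : List T) (t : ℕ) :
    blockMap A (historyInfo m w t) (blockState A w (t / blockLength σ))
      = A.eval (w.take (blockLength σ * (t / blockLength σ))) := by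
  rw [blockMap, previousWord_historyInfo hm, blockState, DFA.eval,
    ← DFA.evalFrom_of_append]
  congr 1
  conv_rhs => rw [← List.take_append_drop (blockLength σ * (t / blockLength σ - 1))
    (w.take (blockLength σ * (t / blockLength σ)))]
  rw [List.take_take, min_eq_left (Nat.mul_le_mul_left _ (Nat.sub_le _ _))]

variable [DecidableEq σ] [DecidableEq T] [Fintype T]

/-- While a block is read, the state is updated by the map of the block before it.  The receptance
completes this map, and accounts for the current block; the sign of the readout then says whether
the prefix read is accepted.  At the first position the state is still zero, so that the key need
not act on it and can serve to store the initial state. -/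
def automatonUpdate : Update (Info T m) (Pat T m) (KeyChan m σ) where
  key := fun i => if i.first then Pi.single (stateKey m false A.start) 1 else
    (mapKeys m (blockMap A i))[blockIndex σ i]'(by
      rw [length_mapKeys]; exact blockIndex_lt i)
  read := fun i => ((mapKeys m (blockMap A i)).drop (blockIndex σ i + 1)).foldr
    (fun u y => projAlong y u) (acceptSign A i)
  cur := firstCoeff
  prev := 0
  learn := rate
  bonus := 0
  target := Set.univ
  old := fun i => ⟨i.tok, i.first, i.pos, i.hist, false⟩
  coeff := fun i => unitCoeff (Info T m) (KeyChan m σ)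
    ((if i.acc then 1 else -1 : ℝ) • countPat T m false)
  learn_pos := rate_pos
  learn_lt_one := rate_lt_one
  inj := by
    rintro ⟨tok, first, p, hist, acc⟩ - ⟨tok', first', q, hist', acc'⟩ - hold hc
    obtain ⟨c, hc0, he⟩ := exists_unitCoeff_eq_smul (I := Info T m) (K := KeyChan m σ)
      (countPat_ne_zero (T := T) (m := m) false)
    simp only [Info.mk.injEq] at hold
    obtain ⟨rfl, rfl, rfl, rfl, -⟩ := hold
    have h0 := congrFun hc (.inl false)
    have h1 : countPat T m false (.inl false) = 1 := by simp [countPat]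
    cases acc <;> cases acc' <;>
      simp only [reduceCtorEq, if_true, if_false, neg_smul, one_smul, unitCoeff_neg, he,
        Pi.neg_apply, Pi.smul_apply, smul_eq_mul, h1] at h0 ⊢ <;>
      linarith

theorem valueCoeff_automatonUpdate (w : List T) (t : ℕ) :
    valueCoeff (automatonUpdate (m := m) A).cur (automatonUpdate (m := m) A).prev
      (historyInfo m w) t = if t = 0 then countPat T m false else 0 := by
  simp [valueCoeff, automatonUpdate, firstCoeff, historyInfo]

theorem automaton_state (hm : m = 2 * blockLength σ) (w : List T) {n : ℕ}
    {z : ℕ → Pat T m → KeyChan m σ → ℝ}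
    (hz : IsStateSeq rate n (fun s => (automatonUpdate A).key (historyInfo m w s))
      (valueCoeff (automatonUpdate A).cur (automatonUpdate A).prev (historyInfo m w)) z)
    {t : ℕ} (ht : t < n) :
    ∃ c : ℝ, 0 < c ∧ z (t + 1) (.inl false)
      = c • ((mapKeys m (blockMap A (historyInfo m w t))).take (t % blockLength σ + 1)).foldl
          projAlong (Pi.single (stateKey m false (blockState A w (t / blockLength σ))) 1) := by
  have hdvd : blockLength σ ∣ m := ⟨2, by omega⟩
  have hB : 0 < blockLength σ := Nat.succ_pos _
  induction t with
  | zero =>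
    refine ⟨1, one_pos, ?_⟩
    have hs : blockState A w 0 = A.start := by simp [blockState]
    rw [hz.2 0 ht, hz.1, valueCoeff_automatonUpdate]
    simp only [Nat.zero_mod, Nat.zero_div, hs, mapKeys, List.take_succ_cons, List.take_zero,
      List.foldl_cons, List.foldl_nil, projAlong_idle]
    simp [automatonUpdate, historyInfo, countPat]
  | succ t ih =>
    obtain ⟨c, hc, h⟩ := ih (by omega)
    set f := blockMap A (historyInfo m w (t + 1)) with hf
    have hj : (t + 1) % blockLength σ < (mapKeys m f).length := by
      rw [length_mapKeys]; exact Nat.mod_lt _ hB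
    have hkey : (automatonUpdate A).key (historyInfo m w (t + 1))
        = (mapKeys m f)[(t + 1) % blockLength σ] := by
      have hfirst : (historyInfo m w (t + 1)).first = false := by simp [historyInfo]
      simp only [automatonUpdate, hfirst, blockIndex_historyInfo hdvd]
      rfl
    have hstep : z (t + 1 + 1) (.inl false) = rate • projAlong (z (t + 1) (.inl false))
        ((mapKeys m f)[(t + 1) % blockLength σ]) := by
      rw [hz.2 (t + 1) ht, valueCoeff_automatonUpdate]
      beta_reduce
      rw [hkey, projAlong, smul_sub, smul_smul]
      simp
    -- Before the step, the keys of the block with smaller index have acted on its initial state.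
    obtain ⟨d, hd, hbefore⟩ : ∃ d : ℝ, 0 < d ∧ z (t + 1) (.inl false)
        = d • ((mapKeys m f).take ((t + 1) % blockLength σ)).foldl projAlong
          (Pi.single (stateKey m false (blockState A w ((t + 1) / blockLength σ))) 1) := by
      have hlt := Nat.mod_lt t hB
      have hdm := Nat.div_add_mod t (blockLength σ)
      by_cases hlast : t % blockLength σ + 1 = blockLength σ
      · have h1 : t + 1 = blockLength σ * (t / blockLength σ + 1) := by rw [Nat.mul_succ]; omega
        have h2 : (t + 1) % blockLength σ = 0 := by rw [h1, Nat.mul_mod_right]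
        have h3 : (t + 1) / blockLength σ = t / blockLength σ + 1 := by
          rw [h1, Nat.mul_div_cancel_left _ hB]
        obtain ⟨d, hd, he⟩ := foldl_mapKeys (m := m) (blockMap A (historyInfo m w t))
          (blockState A w (t / blockLength σ))
        refine ⟨c * d, mul_pos hc hd, ?_⟩
        rw [h, hlast, List.take_of_length_le (length_mapKeys _).le, he, h2, h3, smul_smul,
          blockMap_blockState A hm, List.take_zero, List.foldl_nil]
        simp [blockState]
      · have h1 : t + 1 = blockLength σ * (t / blockLength σ) + (t % blockLength σ + 1) := by omega
        have h2 : (t + 1) % blockLength σ = t % blockLength σ + 1 := by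
          rw [h1, Nat.mul_add_mod, Nat.mod_eq_of_lt (by omega)]
        have h3 : (t + 1) / blockLength σ = t / blockLength σ := by
          rw [h1, Nat.mul_add_div hB,
            Nat.div_eq_of_lt (show t % blockLength σ + 1 < blockLength σ by omega), add_zero]
        have h4 : f = blockMap A (historyInfo m w t) := by
          funext s
          rw [hf, blockMap, blockMap, previousWord_historyInfo hm, previousWord_historyInfo hm, h3]
        exact ⟨c, hc, by rw [h, h2, h3, h4]⟩
    refine ⟨rate * d, mul_pos rate_pos hd, ?_⟩
    rw [hstep, hbefore, projAlong_smul, smul_smul, ← List.take_append_getElem hj,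
      List.foldl_append, List.foldl_cons, List.foldl_nil]

theorem automatonUpdate_runs (hm : m = 2 * blockLength σ) (w : List T) :
    (automatonUpdate A).Runs w.length (historyInfo m w) (acceptInfo A m w) := by
  have hdvd : blockLength σ ∣ m := ⟨2, by omega⟩
  obtain ⟨z, hz⟩ := exists_isStateSeq rate
    (fun s => (automatonUpdate A).key (historyInfo m w s))
    (valueCoeff (automatonUpdate A).cur (automatonUpdate A).prev (historyInfo m w))
  have hread : ∀ t < w.length, ∃ c : ℝ, 0 < c ∧
      readCoeff (automatonUpdate A).read (historyInfo m w) z t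
        = c • ((if (acceptInfo A m w t).acc then 1 else -1 : ℝ) • countPat T m false) := by
    intro t ht
    obtain ⟨c, hc, h⟩ := automaton_state A hm w (hz _) ht
    obtain ⟨d, hd, he⟩ := foldl_mapKeys (m := m) (blockMap A (historyInfo m w t))
      (blockState A w (t / blockLength σ))
    refine ⟨c * d, mul_pos hc hd, ?_⟩
    funext ρ
    by_cases hρ : ρ = .inl false
    · subst hρ
      have hsign : acceptSign A (historyInfo m w t)
          (stateKey m false (A.eval (w.take (blockLength σ * (t / blockLength σ)))))
          = if (acceptInfo A m w t).acc then 1 else -1 := by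
        have : A.evalFrom (A.eval (w.take (blockLength σ * (t / blockLength σ))))
            (currentWord σ (historyInfo m w t)) = A.eval (w.take (t + 1)) := by
          rw [currentWord_historyInfo hdvd, DFA.eval, ← DFA.evalFrom_of_append,
            ← List.take_add, ← add_assoc, Nat.div_add_mod]
        simp only [acceptSign, stateKey, acceptInfo]
        rw [this]
        by_cases hacc : A.eval (w.take (t + 1)) ∈ A.accept <;> simp [hacc]
      have hr : (automatonUpdate A).read (historyInfo m w t)
          = ((mapKeys m (blockMap A (historyInfo m w t))).drop (t % blockLength σ + 1)).foldr
            (fun u y => projAlong y u) (acceptSign A (historyInfo m w t)) := by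
        simp only [automatonUpdate, blockIndex_historyInfo hdvd]
      rw [readCoeff, h, dotProduct_comm, hr, smul_dotProduct, ← foldl_projAlong_dotProduct,
        ← List.foldl_append, List.take_append_drop, he, smul_dotProduct, blockMap_blockState A hm,
        single_one_dotProduct, hsign]
      simp only [smul_eq_mul, Pi.smul_apply, countPat, Pi.single_eq_same, mul_one]
      ring
    · have h0 : z (t + 1) ρ = 0 := by
        refine state_eq_zero (hz w.length) (fun s _ => ?_) ht
        rw [valueCoeff_automatonUpdate]
        split_ifs
        · simp [countPat, hρ]
        · rfl
      rw [readCoeff, h0, Pi.smul_apply, Pi.smul_apply, countPat, Pi.single_eq_of_ne hρ]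
      simp
  have hne : ∀ b : Bool, (if b then 1 else -1 : ℝ) • countPat T m false ≠ 0 := fun b =>
    smul_ne_zero (by cases b <;> simp) (countPat_ne_zero _)
  refine ⟨z, hz _, fun t ht => ⟨trivial, rfl, ?_, ?_, ?_⟩⟩
  · simp only [automatonUpdate]
    split_ifs
    · intro h
      have := congrFun h (stateKey m false A.start)
      simp at this
    · exact mapKeys_ne_zero _ _ (List.getElem_mem _)
  · obtain ⟨c, hc, h⟩ := hread t ht
    rw [h]
    exact smul_ne_zero hc.ne' (hne _)
  · obtain ⟨c, hc, h⟩ := hread t ht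
    rw [h, unitCoeff_smul hc]
    simp [automatonUpdate]

end AutomatonLayer

/-! ### Recognizing regular languages -/

/-- Over a vocabulary whose tokens are mapped to the letters of a finite automaton, some model with
four layers decides which words the automaton accepts. -/
theorem exists_model_dfa {V : Type*} {T σ : Type} [Fintype T] [Fintype σ] (tok : V → T)
    (A : DFA T σ) : ∃ H N : ℕ, 0 < H ∧ 0 < N ∧ ∃ M : Model V H N 4, ∀ w : List V, w ≠ [] →
      (w.map tok ∈ A.accepts → M.Outputs w 1) ∧ (w.map tok ∉ A.accepts → M.Outputs w 0) := by
  classical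
  obtain ⟨m, hm⟩ : ∃ m, m = 2 * blockLength σ := ⟨_, rfl⟩
  have hcard : 0 < Fintype.card σ := Fintype.card_pos_iff.2 ⟨A.start⟩
  have hm3 : 3 ≤ m := by rw [hm, blockLength]; omega
  have : NeZero m := ⟨by omega⟩
  obtain ⟨M, hM⟩ := Update.exists_model (V := V) (parityUpdate (T := T) (σ := σ) (m := m))
    (counterUpdate hm3) historyUpdate (automatonUpdate A) firstCoeff
    (fun v => ⟨some (tok v), false, 0, fun _ => none, false⟩) {i | i.acc = true}
  refine ⟨1, dim (Info T m) (Pat T m) (KeyChan m σ), one_pos,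
    Fintype.card_pos_iff.2 ⟨.inr (.inl (.inl true, true))⟩, M, fun w hw => ?_⟩
  have hlen : (w.map tok).length = w.length := List.length_map _
  obtain ⟨hreg, hout⟩ := hM w (tokenInfo m (w.map tok)) (parityInfo m (w.map tok))
    (counterInfo m (w.map tok)) (historyInfo m (w.map tok)) (acceptInfo A m (w.map tok))
    (fun t ht => ⟨w[t], by simp [ht], by simp [tokenInfo, ht]⟩)
    (hlen ▸ parityUpdate_runs (by omega) _) (hlen ▸ counterUpdate_runs hm3 ⟨_, hm⟩ _)
    (hlen ▸ historyUpdate_runs _) (hlen ▸ automatonUpdate_runs A hm _)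
    (fun t _ => ⟨by rw [valueCoeff_parityUpdate]; simp [firstCoeff, parityInfo], rfl, rfl⟩)
  have hpos := List.length_pos_iff.2 hw
  have hacc : acceptInfo A m (w.map tok) (w.length - 1) ∈ {i : Info T m | i.acc = true}
      ↔ w.map tok ∈ A.accepts := by
    have : (w.map tok).take (w.length - 1 + 1) = w.map tok :=
      List.take_of_length_le (by rw [hlen]; omega)
    simp only [Set.mem_ofPred_eq, acceptInfo, this, decide_eq_true_eq]
    rfl
  rw [← hacc]
  have := hout (w.length - 1) (by omega)
  exact ⟨fun h => ⟨hreg, this.1 h⟩, fun h => ⟨hreg, this.2 h⟩⟩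

/-- The automaton that skips the symbols `none`. -/
def skipNone {T σ : Type} (A : DFA T σ) : DFA (Option T) σ where
  step s a := a.elim s (A.step s)
  start := A.start
  accept := A.accept

theorem evalFrom_skipNone {T σ : Type} (A : DFA T σ) (s : σ) (w : List T) :
    (skipNone A).evalFrom s (w.map some) = A.evalFrom s w := by
  induction w generalizing s with
  | nil => rfl
  | cons a w ih => exact ih (A.step s a)

end RWKV7

open RWKV7 in
theorem theorem4p4 {Γ : Type*} [Fintype Γ] (L : Language Γ) (hL : L.IsRegular) :
    (∃ H N : ℕ, 0 < H ∧ 0 < N ∧ ∃ M : RWKV7.Model Γ H N 4,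
      ∀ w : List Γ, w ≠ [] → (w ∈ L → M.Outputs w 1) ∧ (w ∉ L → M.Outputs w 0)) ∧
    (∃ H N : ℕ, 0 < H ∧ 0 < N ∧ ∃ M : RWKV7.Model (Option Γ) H N 4,
      ∀ w : List Γ, (w ∈ L → M.Outputs (none :: w.map some) 1) ∧
        (w ∉ L → M.Outputs (none :: w.map some) 0)) := by
  obtain ⟨σ, hσ, B, rfl⟩ := hL
  -- The letters are replaced by elements of a type in the lowest universe.
  let e := Fintype.equivFin Γ
  let A : DFA (Fin (Fintype.card Γ)) σ := ⟨fun s a => B.step s (e.symm a), B.start, B.accept⟩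
  have hA : ∀ w : List Γ, w.map e ∈ A.accepts ↔ w ∈ B.accepts := by
    have h : ∀ (w : List Γ) (s : σ), A.evalFrom s (w.map e) = B.evalFrom s w := by
      intro w
      induction w with
      | nil => exact fun _ => rfl
      | cons a w ih =>
        intro s
        have : A.step s (e a) = B.step s a := by simp [A]
        rw [List.map_cons, DFA.evalFrom_cons, DFA.evalFrom_cons, this, ih]
    intro w
    rw [DFA.mem_accepts, DFA.mem_accepts, DFA.eval, DFA.eval, h]
  refine ⟨?_, ?_⟩
  · obtain ⟨H, N, hH, hN, M, hM⟩ := exists_model_dfa e A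
    refine ⟨H, N, hH, hN, M, fun w hw => ?_⟩
    rw [← hA]
    exact hM w hw
  · obtain ⟨H, N, hH, hN, M, hM⟩ := exists_model_dfa (Option.map e) (skipNone A)
    refine ⟨H, N, hH, hN, M, fun w => ?_⟩
    have hw : (none :: w.map some).map (Option.map e) ∈ (skipNone A).accepts ↔ w ∈ B.accepts := by
      rw [← hA]
      have : (none :: w.map some).map (Option.map e) = none :: (w.map e).map some := by simp
      rw [this, DFA.mem_accepts, DFA.mem_accepts, DFA.eval, DFA.eval, DFA.evalFrom_cons,
        ← evalFrom_skipNone A]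
      rfl
    rw [← hw]
    exact hM _ (by simp)

end
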